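/- **Conventions.** All graphs are finite, simple and undirected, with $n\ge 1$ vertices. For integers $q\ge k\ge 1$ and $i\ge 0$, a proper $(q,k,i)$-coloring of a graph $G=(V,E)$ is a map $h:V\to\binom{[q]}{k}$ from the vertices to the $k$-element subsets of $[q]=\{1,\dots,q\}$ with $|h(u)\cap h(v)|\le i$ for every edge $uv$. The $(q,k,i)$-coloring problem asks whether such an $h$ exists; the $(k,i)$-coloring problem asks for $\chi_k^i(G)$, the least $q$ for which one exists. A feedback vertex set of $G$ is a set $S\subseteq V$ such that $G[V\setminus S]$ is acyclic. Algorithms are programs for a word RAM with unit-cost operations on words of $O(\log(nq))$ bits (of $O(\log n)$ bits in part (2)); the graph is given by its adjacency matrix and $S$ by its indicator vector, in a read-only input array. Space is counted in bits, and the read-only input is not counted. **Theorem.** There is an absolute constant $d$ such that the following holds for all fixed integers $k\ge 1$ and $i\ge 0$; the programs, and the constants in all $O(\cdot)$, depend only on $k$ and $i$. 1. There is a program that, given $q\ge k$, a graph $G$ and a feedback vertex set $S$ of $G$, decides whether $G$ has a proper $(q,k,i)$-coloring in time $$O\!\left(\binom{q}{k}^{|S|+2} n^{d}\right)$$ and,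 in the same run, in space $O\!\left(\binom{q}{k}\,n\right)$. 2. The $(k,i)$-coloring problem, with a feedback vertex set given as part of the input, is fixed-parameter tractable in the size of that set: there are a program and a computable function $f:\mathbb N\to\mathbb N$ with $$f(s)=O\!\left(\log_2\!\big(k(s+2)\big)\cdot\binom{k(s+2)}{k}^{s+2}\right)$$ such that the program, given a graph $G$ and a feedback vertex set $S$ of $G$, computes $\chi_k^i(G)$ in time at most $f(|S|)\,n^{d}$. -/

import Mathlib

/-! ### Proper `(q,k,i)`-colorings and feedback vertex sets -/

/-- `h` assigns to every vertex a set of `k` of the `q` colors, and adjacent vertices have at most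
`i` colors in common. -/
def IsProperColoring {V : Type*} (G : SimpleGraph V) (q k i : ℕ) (h : V → Finset (Fin q)) : Prop :=
  (∀ v, (h v).card = k) ∧ ∀ u v, G.Adj u v → (h u ∩ h v).card ≤ i

/-- The question asked by the `(q,k,i)`-coloring problem. -/
def QKIColorable {V : Type*} (G : SimpleGraph V) (q k i : ℕ) : Prop :=
  ∃ h : V → Finset (Fin q), IsProperColoring G q k i h

/-- `x` is the `(k,i)`-chromatic number of `G`: the least number of colors that suffices. -/
def IsKIChromaticNumber {V : Type*} (G : SimpleGraph V) (k i x : ℕ) : Prop :=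
  IsLeast {q : ℕ | QKIColorable G q k i} x

/-- `S` is a feedback vertex set: removing `S` leaves an acyclic graph. -/
def IsFeedbackVertexSet {V : Type*} (G : SimpleGraph V) (S : Finset V) : Prop :=
  (G.induce ((S : Set V)ᶜ)).IsAcyclic

/-! ### Word RAM programs, with their running time and their space in bits

A machine has registers holding words of `w` bits, a read-only input array of words, and a
read-write random access work memory. A run that overflows a word or a memory cell, or that
addresses a cell outside the work memory, is not a legal run: it has no derivation below. -/

/-- Word operations; comparisons return `1` or `0`, subtraction is truncated. -/
inductive WOp
  | add | sub | mul | div | mod | lt | eq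

def WOp.apply : WOp → ℕ → ℕ → ℕ
  | .add, a, b => a + b
  | .sub, a, b => a - b
  | .mul, a, b => a * b
  | .div, a, b => a / b
  | .mod, a, b => a % b
  | .lt, a, b => if a < b then 1 else 0
  | .eq, a, b => if a = b then 1 else 0

/-- Expressions: literals, registers, reading an input word, reading a memory cell, operations. -/
inductive WExpr
  | lit (m : ℕ)
  | reg (x : ℕ)
  | input (a : WExpr)
  | load (a : WExpr)
  | op (o : WOp) (a b : WExpr)

/-- Programs of the word RAM. A condition holds when its value is not `0`. -/
inductive WProg
  | skip
  | assign (x : ℕ) (e : WExpr)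
  | store (a e : WExpr)
  | seq (p r : WProg)
  | branch (e : WExpr) (p r : WProg)
  | loop (e : WExpr) (p : WProg)

/-- The hardware: word length `w` in bits, input array, and work memory, whose cell number `a`
has `cells[a]` bits. -/
structure WMachine where
  w : ℕ
  input : List ℕ
  cells : List ℕ

/-- Contents of the registers and of the work memory. -/
structure WState where
  regs : ℕ → ℕ
  mem : ℕ → ℕ

/-- At the start all registers and all memory cells are `0`. -/
def WState.start : WState := ⟨fun _ => 0, fun _ => 0⟩

/-- Value of an expression; an input position beyond the end of the input reads as `0`. -/
def WExpr.eval (M : WMachine) (σ : WState) : WExpr → ℕ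
  | .lit m => m
  | .reg x => σ.regs x
  | .input a => M.input.getD (a.eval M σ) 0
  | .load a => σ.mem (a.eval M σ)
  | .op o a b => o.apply (a.eval M σ) (b.eval M σ)

/-- The evaluation is legal: every intermediate value fits into a word of `w` bits, and only
existing memory cells are read. -/
def WExpr.Fits (M : WMachine) (σ : WState) : WExpr → Prop
  | .lit m => m < 2 ^ M.w
  | .reg x => σ.regs x < 2 ^ M.w
  | .input a => a.Fits M σ ∧ M.input.getD (a.eval M σ) 0 < 2 ^ M.w
  | .load a => a.Fits M σ ∧ a.eval M σ < M.cells.length ∧ σ.mem (a.eval M σ) < 2 ^ M.w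
  | .op o a b => a.Fits M σ ∧ b.Fits M σ ∧ o.apply (a.eval M σ) (b.eval M σ) < 2 ^ M.w

/-- Time to evaluate an expression: one step for every literal, register access, input access,
memory access and word operation. -/
def WExpr.cost : WExpr → ℕ
  | .lit _ => 1
  | .reg _ => 1
  | .input a => a.cost + 1
  | .load a => a.cost + 1
  | .op _ a b => a.cost + b.cost + 1

/-- `WExec M p σ t σ'`: on the machine `M`, the program `p` started in the state `σ` halts after
`t` steps in the state `σ'`. -/
inductive WExec (M : WMachine) : WProg → WState → ℕ → WState → Prop
  | skip (σ : WState) : WExec M .skip σ 1 σ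
  | assign (x : ℕ) (e : WExpr) (σ : WState) (he : e.Fits M σ) :
      WExec M (.assign x e) σ (e.cost + 1) ⟨Function.update σ.regs x (e.eval M σ), σ.mem⟩
  | store (a e : WExpr) (σ : WState) (ha : a.Fits M σ) (he : e.Fits M σ)
      (hcell : a.eval M σ < M.cells.length)
      (hbits : e.eval M σ < 2 ^ M.cells[a.eval M σ]) :
      WExec M (.store a e) σ (a.cost + e.cost + 1)
        ⟨σ.regs, Function.update σ.mem (a.eval M σ) (e.eval M σ)⟩
  | seq (p r : WProg) (σ₀ σ₁ σ₂ : WState) (t₁ t₂ : ℕ)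
      (h₁ : WExec M p σ₀ t₁ σ₁) (h₂ : WExec M r σ₁ t₂ σ₂) :
      WExec M (.seq p r) σ₀ (t₁ + t₂) σ₂
  | branch_true (e : WExpr) (p r : WProg) (σ σ' : WState) (t : ℕ) (he : e.Fits M σ)
      (hc : e.eval M σ ≠ 0) (h : WExec M p σ t σ') :
      WExec M (.branch e p r) σ (e.cost + 1 + t) σ'
  | branch_false (e : WExpr) (p r : WProg) (σ σ' : WState) (t : ℕ) (he : e.Fits M σ)
      (hc : e.eval M σ = 0) (h : WExec M r σ t σ') :
      WExec M (.branch e p r) σ (e.cost + 1 + t) σ'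
  | loop_stop (e : WExpr) (p : WProg) (σ : WState) (he : e.Fits M σ) (hc : e.eval M σ = 0) :
      WExec M (.loop e p) σ (e.cost + 1) σ
  | loop_step (e : WExpr) (p : WProg) (σ₀ σ₁ σ₂ : WState) (t₁ t₂ : ℕ) (he : e.Fits M σ₀)
      (hc : e.eval M σ₀ ≠ 0) (h₁ : WExec M p σ₀ t₁ σ₁) (h₂ : WExec M (.loop e p) σ₁ t₂ σ₂) :
      WExec M (.loop e p) σ₀ (e.cost + 1 + t₁ + t₂) σ₂

/-- The registers that occur in an expression. -/
def WExpr.registers : WExpr → Finset ℕ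
  | .lit _ => ∅
  | .reg x => {x}
  | .input a => a.registers
  | .load a => a.registers
  | .op _ a b => a.registers ∪ b.registers

/-- The registers that occur in a program. -/
def WProg.registers : WProg → Finset ℕ
  | .skip => ∅
  | .assign x e => insert x e.registers
  | .store a e => a.registers ∪ e.registers
  | .seq p r => p.registers ∪ r.registers
  | .branch e p r => e.registers ∪ p.registers ∪ r.registers
  | .loop e p => e.registers ∪ p.registers

/-- The program `p`, started on the machine `M` with empty registers and memory, halts after `t`
steps with the value `out` in the output register `0`. -/
def WProg.Outputs (p : WProg) (M : WMachine) (t out : ℕ) : Prop :=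
  ∃ σ : WState, WExec M p WState.start t σ ∧ σ.regs 0 = out

/-- The space in bits that `p` uses on `M`: `w` bits for each register (with the output register)
and the bits of all cells of the work memory, at least one for each cell. The read-only input is
not counted. -/
def WProg.spaceBits (p : WProg) (M : WMachine) : ℕ :=
  (insert 0 p.registers).card * M.w + (M.cells.map (max 1)).sum

/-! ### Encoding of the instances -/

open Classical in
/-- The words `n`, then the `n` membership bits of `S`, then the adjacency matrix row by row. -/
noncomputable def encodeGraph {n : ℕ} (G : SimpleGraph (Fin n)) (S : Finset (Fin n)) : List ℕ :=
  n :: (List.ofFn (fun v : Fin n => if v ∈ S then 1 else 0) ++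
    List.ofFn (fun e : Fin (n * n) => if G.Adj e.divNat e.modNat then 1 else 0))

/-! ### Total correctness of word RAM programs with time bounds -/

/-! A `k`-subset of the `q` colors is coded by the number below `K = q ^ k` whose base `q` digits
list it in increasing order. There are `q.choose k` codes, and `K` is at most a constant times
`q.choose k` (`card_isCode`, `pow_le_mul_choose`), so ranging over all numbers below `K` instead of
the codes costs only a constant factor.

Fix a coloring of `S`. What remains is a list coloring problem on the forest outside `S`: the list
of a vertex consists of the codes compatible with its colored neighbors in `S`. A vertex with at
most one remaining neighbor can be eliminated by deleting from the list of that neighbor every code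
without a compatible partner; this does not change solvability (`solvable_pruned`). A forest always
offers such a vertex, so `n` sweeps eliminate everything (`sweeps_runs`), and then a solution exists
exactly when no list is empty (`solvable_of_removed`). One coloring of `S` thus costs `O(K ^ 2 * n ^
3)` steps.

The colorings of `S` are enumerated by an odometer with `|S|` digits, each running through the codes
(`inc_runs`, `enum_runs`). This gives the factor `q.choose k ^ |S|`, and the two factors `K` raise
the exponent to `|S| + 2`. The space is dominated by the lists, stored as `n * K` single bits.

For the optimization problem, two colors suffice for the forest and one more for each vertex of `S`;
replacing each color by a block of `k` colors shows that `k * (|S| + 2)` colors are enough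
(`IsFeedbackVertexSet.qkiColorable`). Hence the decision procedure is run for `q = k, k + 1, …`
until it succeeds.

Programs are verified in a calculus of total correctness, `WProg.Runs`, whose triples carry a time
bound. Bounds have the form constant times monomial, and each constant is fixed before the machine
and the instance. -/

open Classical in
/-- The indicator of a proposition. -/
noncomputable def ind (p : Prop) : ℕ := if p then 1 else 0

theorem ind_true {p : Prop} (h : p) : ind p = 1 := by simp [ind, h]

theorem ind_false {p : Prop} (h : ¬p) : ind p = 0 := by simp [ind, h]

theorem ind_congr {p r : Prop} (h : p ↔ r) : ind p = ind r := by rw [propext h]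

theorem ind_le_one (p : Prop) : ind p ≤ 1 := by unfold ind; split_ifs <;> simp

theorem ind_eq_zero {p : Prop} : ind p = 0 ↔ ¬p := by unfold ind; split_ifs <;> simp_all

theorem ind_mul (p r : Prop) : ind p * ind r = ind (p ∧ r) := by
  unfold ind; split_ifs <;> simp_all

theorem ite_eq_ind (p : Prop) [Decidable p] : (if p then 1 else 0) = ind p := by
  unfold ind; split_ifs <;> rfl

/-- The expression evaluates legally to `a`. -/
def WExpr.HasVal (M : WMachine) (σ : WState) (e : WExpr) (a : ℕ) : Prop :=
  e.Fits M σ ∧ e.eval M σ = a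

namespace WExpr.HasVal

variable {M : WMachine} {σ : WState}

theorem congr {e : WExpr} {a b : ℕ} (h : e.HasVal M σ a) (hab : a = b) : e.HasVal M σ b :=
  hab ▸ h

theorem lt {e : WExpr} {a : ℕ} (h : e.HasVal M σ a) : a < 2 ^ M.w := by
  obtain ⟨h1, rfl⟩ := h
  induction e with
  | lit m => exact h1
  | reg x => exact h1
  | input a _ => exact h1.2
  | load a _ => exact h1.2.2
  | op o a b _ _ => exact h1.2.2

theorem lit {m : ℕ} (h : m < 2 ^ M.w) : (WExpr.lit m).HasVal M σ m := ⟨h, rfl⟩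

theorem reg {x a : ℕ} (hx : σ.regs x = a) (h : a < 2 ^ M.w) : (WExpr.reg x).HasVal M σ a :=
  ⟨by simpa [Fits, hx] using h, hx⟩

theorem input {e : WExpr} {a b : ℕ} (he : e.HasVal M σ a) (hb : M.input.getD a 0 = b)
    (h : b < 2 ^ M.w) : (WExpr.input e).HasVal M σ b := by
  obtain ⟨h1, rfl⟩ := he
  exact ⟨⟨h1, hb ▸ h⟩, hb⟩

theorem load {e : WExpr} {a b : ℕ} (he : e.HasVal M σ a) (hc : a < M.cells.length)
    (hb : σ.mem a = b) (h : b < 2 ^ M.w) : (WExpr.load e).HasVal M σ b := by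
  obtain ⟨h1, rfl⟩ := he
  exact ⟨⟨h1, hc, hb ▸ h⟩, hb⟩

theorem op {o : WOp} {e f : WExpr} {a b : ℕ} (he : e.HasVal M σ a) (hf : f.HasVal M σ b)
    (h : o.apply a b < 2 ^ M.w) : (WExpr.op o e f).HasVal M σ (o.apply a b) := by
  obtain ⟨h1, rfl⟩ := he
  obtain ⟨h2, rfl⟩ := hf
  exact ⟨⟨h1, h2, h⟩, rfl⟩

theorem add {e f : WExpr} {a b : ℕ} (he : e.HasVal M σ a) (hf : f.HasVal M σ b)
    (h : a + b < 2 ^ M.w) : (WExpr.op .add e f).HasVal M σ (a + b) := op he hf h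

theorem mul {e f : WExpr} {a b : ℕ} (he : e.HasVal M σ a) (hf : f.HasVal M σ b)
    (h : a * b < 2 ^ M.w) : (WExpr.op .mul e f).HasVal M σ (a * b) := op he hf h

theorem div {e f : WExpr} {a b : ℕ} (he : e.HasVal M σ a) (hf : f.HasVal M σ b) :
    (WExpr.op .div e f).HasVal M σ (a / b) :=
  op he hf ((Nat.div_le_self _ _).trans_lt he.lt)

theorem mod {e f : WExpr} {a b : ℕ} (he : e.HasVal M σ a) (hf : f.HasVal M σ b) :
    (WExpr.op .mod e f).HasVal M σ (a % b) :=
  op he hf ((Nat.mod_le _ _).trans_lt he.lt)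

theorem mul_ind {e f : WExpr} {p r : Prop} (he : e.HasVal M σ (ind p))
    (hf : f.HasVal M σ (ind r)) (h : 1 < 2 ^ M.w) :
    (WExpr.op .mul e f).HasVal M σ (ind (p ∧ r)) :=
  congr (mul he hf (by rw [ind_mul]; exact (ind_le_one _).trans_lt h)) (ind_mul p r)

theorem lt_ind {e f : WExpr} {a b : ℕ} (he : e.HasVal M σ a) (hf : f.HasVal M σ b)
    (h : 1 < 2 ^ M.w) : (WExpr.op .lt e f).HasVal M σ (ind (a < b)) := by
  have := op (o := .lt) he hf (by simp only [WOp.apply]; split_ifs <;> omega)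
  exact this.congr (by simp [WOp.apply, ind])

theorem eq_ind {e f : WExpr} {a b : ℕ} (he : e.HasVal M σ a) (hf : f.HasVal M σ b)
    (h : 1 < 2 ^ M.w) : (WExpr.op .eq e f).HasVal M σ (ind (a = b)) := by
  have := op (o := .eq) he hf (by simp only [WOp.apply]; split_ifs <;> omega)
  exact this.congr (by simp [WOp.apply, ind])

end WExpr.HasVal

/-- Negation of a truth value. -/
def WExpr.neg (e : WExpr) : WExpr := .op .eq e (.lit 0)

theorem WExpr.HasVal.neg {M : WMachine} {σ : WState} {e : WExpr} {p : Prop}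
    (he : e.HasVal M σ (ind p)) (h : 1 < 2 ^ M.w) : e.neg.HasVal M σ (ind (¬p)) :=
  (WExpr.HasVal.eq_ind he (.lit (by omega)) h).congr (ind_congr ind_eq_zero)

/-- The sum of the first `m` of a list of expressions. -/
def WExpr.sum (f : ℕ → WExpr) : ℕ → WExpr
  | 0 => .lit 0
  | m + 1 => .op .add (WExpr.sum f m) (f m)

theorem WExpr.HasVal.sum {M : WMachine} {σ : WState} {f : ℕ → WExpr} {a : ℕ → ℕ} :
    ∀ {m : ℕ}, (∀ j < m, (f j).HasVal M σ (a j)) → ∑ j ∈ Finset.range m, a j < 2 ^ M.w →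
      (WExpr.sum f m).HasVal M σ (∑ j ∈ Finset.range m, a j)
  | 0, _, h => .lit (by simp)
  | m + 1, hf, h => by
    rw [Finset.sum_range_succ] at h ⊢
    exact .add (WExpr.HasVal.sum (fun j hj => hf j (by omega)) (by omega)) (hf m (by omega)) h

/-- The `m`-th power of an expression. -/
def WExpr.pow (e : WExpr) : ℕ → WExpr
  | 0 => .lit 1
  | m + 1 => .op .mul (WExpr.pow e m) e

/-- The condition `1 ≤ a` makes the powers monotone, so a word that holds the last power holds all
intermediate ones. -/
theorem WExpr.HasVal.pow {M : WMachine} {σ : WState} {e : WExpr} {a : ℕ} (ha : 1 ≤ a)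
    (he : e.HasVal M σ a) : ∀ {m : ℕ}, a ^ m < 2 ^ M.w → (e.pow m).HasVal M σ (a ^ m)
  | 0, h => .lit (by simpa using h)
  | m + 1, h => by
    have : a ^ m ≤ a ^ (m + 1) := Nat.pow_le_pow_right ha (by omega)
    exact .mul (WExpr.HasVal.pow ha he (by omega)) he h

/-- The state with a new value in register `x`. -/
def WState.setReg (σ : WState) (x a : ℕ) : WState := ⟨Function.update σ.regs x a, σ.mem⟩

/-- The state with a new value in memory cell `x`. -/
def WState.setMem (σ : WState) (x a : ℕ) : WState := ⟨σ.regs, Function.update σ.mem x a⟩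

@[simp] theorem WState.setReg_mem (σ : WState) (x a : ℕ) : (σ.setReg x a).mem = σ.mem := rfl

@[simp] theorem WState.setMem_regs (σ : WState) (x a : ℕ) : (σ.setMem x a).regs = σ.regs := rfl

@[simp] theorem WState.setReg_regs (σ : WState) (x a y : ℕ) :
    (σ.setReg x a).regs y = if y = x then a else σ.regs y := by
  simp [WState.setReg, Function.update_apply]

@[simp] theorem WState.setMem_mem (σ : WState) (x a y : ℕ) :
    (σ.setMem x a).mem y = if y = x then a else σ.mem y := by
  simp [WState.setMem, Function.update_apply]

/-- The program does not assign to register `x`. -/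
def WProg.Keeps (x : ℕ) : WProg → Prop
  | .skip => True
  | .assign y _ => x ≠ y
  | .store _ _ => True
  | .seq p r => p.Keeps x ∧ r.Keeps x
  | .branch _ p r => p.Keeps x ∧ r.Keeps x
  | .loop _ p => p.Keeps x

/-- The frame rule: `Keeps` is a syntactic condition, so preservation of the parameter registers is
settled by `simp` and never enters a loop invariant. -/
theorem WExec.regs_eq {M : WMachine} {p : WProg} {σ σ' : WState} {t x : ℕ}
    (h : WExec M p σ t σ') : p.Keeps x → σ'.regs x = σ.regs x := by
  induction h with
  | skip => intro; rfl
  | assign y e σ _ => intro hx; exact Function.update_of_ne hx _ _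
  | store => intro; rfl
  | seq _ _ _ _ _ _ _ _ _ ih₁ ih₂ => intro hx; rw [ih₂ hx.2, ih₁ hx.1]
  | branch_true _ _ _ _ _ _ _ _ _ ih => intro hx; exact ih hx.1
  | branch_false _ _ _ _ _ _ _ _ _ ih => intro hx; exact ih hx.2
  | loop_stop => intro; rfl
  | loop_step _ _ _ _ _ _ _ _ _ _ _ ih₁ ih₂ => intro hx; rw [ih₂ hx, ih₁ hx]

/-- Started in `σ`, the program halts within `T` steps in a state that satisfies `Q`. -/
def WProg.Runs (M : WMachine) (p : WProg) (σ : WState) (T : ℕ) (Q : WState → Prop) : Prop :=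
  ∃ t σ', WExec M p σ t σ' ∧ t ≤ T ∧ Q σ'

namespace WProg.Runs

variable {M : WMachine} {p r : WProg} {σ : WState} {T T' : ℕ} {Q Q' : WState → Prop}

theorem mono (h : p.Runs M σ T Q) (hT : T ≤ T') (hQ : ∀ τ, Q τ → Q' τ) : p.Runs M σ T' Q' := by
  obtain ⟨t, σ', h1, h2, h3⟩ := h
  exact ⟨t, σ', h1, h2.trans hT, hQ _ h3⟩

theorem frame (h : p.Runs M σ T Q) :
    p.Runs M σ T (fun τ => Q τ ∧ ∀ x, p.Keeps x → τ.regs x = σ.regs x) := by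
  obtain ⟨t, σ', h1, h2, h3⟩ := h
  exact ⟨t, σ', h1, h2, h3, fun x hx => h1.regs_eq hx⟩

theorem skip (hQ : Q σ) : WProg.skip.Runs M σ 1 Q := ⟨1, σ, .skip σ, le_rfl, hQ⟩

theorem assign {x a : ℕ} {e : WExpr} (he : e.HasVal M σ a) (hQ : Q (σ.setReg x a)) :
    (WProg.assign x e).Runs M σ (e.cost + 1) Q := by
  obtain ⟨h1, rfl⟩ := he
  exact ⟨_, _, .assign x e σ h1, le_rfl, hQ⟩

theorem store {e f : WExpr} {a b : ℕ} (he : e.HasVal M σ a) (hf : f.HasVal M σ b)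
    (hc : a < M.cells.length) (hb : b < 2 ^ M.cells[a]) (hQ : Q (σ.setMem a b)) :
    (WProg.store e f).Runs M σ (e.cost + f.cost + 1) Q := by
  obtain ⟨h1, rfl⟩ := he
  obtain ⟨h2, rfl⟩ := hf
  exact ⟨_, _, .store e f σ h1 h2 hc hb, le_rfl, hQ⟩

theorem seq {Q₁ : WState → Prop} (hp : p.Runs M σ T Q₁) (hr : ∀ τ, Q₁ τ → r.Runs M τ T' Q) :
    (WProg.seq p r).Runs M σ (T + T') Q := by
  obtain ⟨t, σ', h1, h2, h3⟩ := hp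
  obtain ⟨t', σ'', h4, h5, h6⟩ := hr _ h3
  exact ⟨_, _, .seq _ _ _ _ _ _ _ h1 h4, by omega, h6⟩

/-- The sum of the two bounds replaces their maximum; this loses only a constant factor and avoids
comparing them. -/
theorem branch {e : WExpr} {c : Prop} (he : e.HasVal M σ (ind c)) (hp : c → p.Runs M σ T Q)
    (hr : ¬c → r.Runs M σ T' Q) : (WProg.branch e p r).Runs M σ (e.cost + 1 + (T + T')) Q := by
  obtain ⟨h1, h2⟩ := he
  by_cases hc : c
  · obtain ⟨t, σ', h3, h4, h5⟩ := hp hc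
    exact ⟨_, _, .branch_true _ _ _ _ _ _ h1 (by simp [h2, ind, hc]) h3, by omega, h5⟩
  · obtain ⟨t, σ', h3, h4, h5⟩ := hr hc
    exact ⟨_, _, .branch_false _ _ _ _ _ _ h1 (by simp [h2, ind, hc]) h3, by omega, h5⟩

/-- A loop that makes exactly `N` rounds. -/
theorem loop {e : WExpr} (I : ℕ → WState → Prop) {N : ℕ} (h0 : I 0 σ)
    (he : ∀ j ≤ N, ∀ τ, I j τ → (∀ x, p.Keeps x → τ.regs x = σ.regs x) →
      e.HasVal M τ (ind (j < N)))
    (hp : ∀ j < N, ∀ τ, I j τ → (∀ x, p.Keeps x → τ.regs x = σ.regs x) →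
      p.Runs M τ T (I (j + 1))) :
    (WProg.loop e p).Runs M σ ((N + 1) * (T + e.cost + 1))
      (fun τ => I N τ ∧ ∀ x, p.Keeps x → τ.regs x = σ.regs x) := by
  -- Induction on the number `m` of rounds still to come. The final failing test is charged as one
  -- more round, hence `m + 1`.
  suffices H : ∀ m j, j + m = N → ∀ τ, I j τ → (∀ x, p.Keeps x → τ.regs x = σ.regs x) →
      (WProg.loop e p).Runs M τ ((m + 1) * (T + e.cost + 1))
        (fun τ => I N τ ∧ ∀ x, p.Keeps x → τ.regs x = σ.regs x) from
    H N 0 (by omega) σ h0 (fun _ _ => rfl)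
  intro m
  induction m with
  | zero =>
    intro j hj τ hI hk
    obtain ⟨h1, h2⟩ := he j (by omega) τ hI hk
    refine ⟨_, τ, WExec.loop_stop _ _ _ h1 (by rw [h2, ind_false (by omega)]), by omega, ?_, hk⟩
    obtain rfl : j = N := by omega
    exact hI
  | succ m ih =>
    intro j hj τ hI hk
    obtain ⟨h1, h2⟩ := he j (by omega) τ hI hk
    obtain ⟨t, τ', h3, h4, h5⟩ := hp j (by omega) τ hI hk
    obtain ⟨t', τ'', h6, h7, h8⟩ := ih (j + 1) (by omega) τ' h5
      (fun x hx => by rw [h3.regs_eq hx, hk x hx])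
    refine ⟨_, τ'', .loop_step _ _ _ _ _ _ _ h1 (by rw [h2, ind_true (by omega)]; simp) h3 h6,
      ?_, h8⟩
    have : (m + 1 + 1) * (T + e.cost + 1) = (m + 1) * (T + e.cost + 1) + (T + e.cost + 1) := by
      ring
    omega

end WProg.Runs

/-- `for x = 0, 1, …, N - 1`, where `N` is the value of register `y`. -/
def WProg.forLoop (x y : ℕ) (p : WProg) : WProg :=
  .seq (.assign x (.lit 0))
    (.loop (.op .lt (.reg x) (.reg y)) (.seq p (.assign x (.op .add (.reg x) (.lit 1)))))

theorem WProg.keeps_forLoop {x y z : ℕ} {p : WProg} :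
    (WProg.forLoop x y p).Keeps z ↔ z ≠ x ∧ p.Keeps z := by
  simp only [WProg.forLoop, WProg.Keeps]; tauto

/-- The body costs `c * A` and the number of rounds is at most `B`, so nesting loops multiplies
monomials and transforms the constants by `c ↦ 2 * c + 20`. The body must establish the invariant
for the state in which the counter has already been advanced. -/
theorem WProg.Runs.forLoop {M : WMachine} {p : WProg} {σ : WState} {c A B x y N : ℕ}
    (I : ℕ → WState → Prop) (hN : σ.regs y = N) (hw : N + 1 < 2 ^ M.w) (hx : p.Keeps x)
    (hy : p.Keeps y) (hxy : y ≠ x) (hA : 1 ≤ A) (hB : 1 ≤ B) (hNB : N ≤ B)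
    (h0 : I 0 (σ.setReg x 0))
    (hp : ∀ j < N, ∀ τ, I j τ → τ.regs x = j →
      (∀ z, p.Keeps z → z ≠ x → τ.regs z = σ.regs z) →
      p.Runs M τ (c * A) (fun τ => I (j + 1) (τ.setReg x (j + 1)))) :
    (WProg.forLoop x y p).Runs M σ ((2 * c + 20) * (A * B))
      (fun τ => I N τ ∧ ∀ z, p.Keeps z → z ≠ x → τ.regs z = σ.regs z) := by
  -- The exact cost: 2 for the initialization and, per round, 4 for the increment, 3 for evaluating
  -- the test and 1 for the jump.
  have key : (WProg.forLoop x y p).Runs M σ (2 + (N + 1) * (c * A + 4 + 3 + 1))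
      (fun τ => I N τ ∧ ∀ z, p.Keeps z → z ≠ x → τ.regs z = σ.regs z) := by
    refine .seq (Q₁ := fun τ => τ = σ.setReg x 0) (.assign (.lit (by omega)) rfl) ?_
    rintro _ rfl
    refine (WProg.Runs.loop (T := c * A + 4) (fun j τ => I j τ ∧ τ.regs x = j) (N := N)
      ⟨h0, by simp⟩ ?_ ?_).mono (by simp [WExpr.cost]) ?_
    · intro j hj τ hI hk
      refine .lt_ind (.reg hI.2 (by omega)) (.reg ?_ (by omega)) (by omega)
      rw [hk y ⟨hy, hxy⟩]
      simp [hxy, hN]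
    · intro j hj τ hI hk
      refine (WProg.Runs.seq (T' := 4) (hp j hj τ hI.1 hI.2 ?_).frame ?_)
      · intro z hz hzx
        rw [hk z ⟨hz, hzx⟩]
        simp [hzx]
      · rintro τ' ⟨h1, h2⟩
        have h3 : τ'.regs x = j := by rw [h2 x hx, hI.2]
        exact .assign (.add (.reg h3 (by omega)) (.lit (by omega)) (by omega))
          ⟨h1, by simp⟩
    · rintro τ ⟨⟨h1, -⟩, h2⟩
      refine ⟨h1, fun z hz hzx => ?_⟩
      rw [h2 z ⟨hz, hzx⟩]
      simp [hzx]
  refine key.mono ?_ fun _ h => h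
  have h1 : (N + 1) * (c * A) ≤ 2 * B * (c * A) := Nat.mul_le_mul_right _ (by omega)
  have h2 : B ≤ A * B := Nat.le_mul_of_pos_left _ hA
  calc 2 + (N + 1) * (c * A + 4 + 3 + 1) = (N + 1) * (c * A) + (8 * N + 10) := by ring
    _ ≤ 2 * B * (c * A) + 20 * (A * B) := by omega
    _ = (2 * c + 20) * (A * B) := by ring

/-! ### Codes of color sets -/

/-- The digit number `j` of `x` in base `q`. -/
def digit (q x j : ℕ) : ℕ := x / q ^ j % q

/-- The digits of `x` in base `q` are strictly increasing, so that they list a `k`-element set. -/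
def IsCode (q k x : ℕ) : Prop := ∀ j, j + 1 < k → digit q x j < digit q x (j + 1)

/-- The color sets with codes `x` and `y` have at most `i` colors in common. -/
def Compat (q k i x y : ℕ) : Prop :=
  ∑ j ∈ Finset.range k, ∑ l ∈ Finset.range k, ind (digit q x j = digit q y l) ≤ i

theorem Compat.symm {q k i x y : ℕ} (h : Compat q k i x y) : Compat q k i y x := by
  unfold Compat at *
  rw [Finset.sum_comm]
  simpa only [eq_comm] using h

/-- The digits of `x` as a sequence of colors. -/
def digitFin (q k x : ℕ) (hq : 0 < q) (j : Fin k) : Fin q := ⟨digit q x j, Nat.mod_lt _ hq⟩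

/-- The color set with code `x`. -/
def colorSet (q k x : ℕ) (hq : 0 < q) : Finset (Fin q) := Finset.univ.image (digitFin q k x hq)

section Codes

variable {q k i : ℕ} (hq : 0 < q)

theorem IsCode.strictMono {x : ℕ} (h : IsCode q k x) : StrictMono (digitFin q k x hq) := by
  -- `IsCode` compares neighboring digits only; induction on the gap between the two positions.
  have H : ∀ m j : ℕ, j + m + 1 < k → digit q x j < digit q x (j + m + 1) := by
    intro m
    induction m with
    | zero => intro j hj; exact h j hj
    | succ m ih => intro j hj; exact (ih j (by omega)).trans (h (j + m + 1) hj)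
  rintro ⟨a, ha⟩ ⟨b, hb⟩ hab
  have hab' : a < b := hab
  have := H (b - a - 1) a (by omega)
  rw [show a + (b - a - 1) + 1 = b by omega] at this
  exact this

theorem IsCode.card_colorSet {x : ℕ} (h : IsCode q k x) : (colorSet q k x hq).card = k := by
  rw [colorSet, Finset.card_image_of_injective _ (h.strictMono hq).injective]
  simp

/-- The digits of a code are distinct, so a digit of `x` agrees with at most one digit of `y`, and
the double sum of `Compat` counts each common color exactly once. -/
theorem IsCode.compat_iff {x y : ℕ} (hx : IsCode q k x) (hy : IsCode q k y) :
    Compat q k i x y ↔ (colorSet q k x hq ∩ colorSet q k y hq).card ≤ i := by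
  have h1 : ∀ j : Fin k, ∑ l : Fin k, ind (digitFin q k x hq j = digitFin q k y hq l) =
      if digitFin q k x hq j ∈ colorSet q k y hq then 1 else 0 := by
    intro j
    split_ifs with h
    · simp only [colorSet, Finset.mem_image, Finset.mem_univ, true_and] at h
      obtain ⟨l, hl⟩ := h
      rw [Finset.sum_eq_single l]
      · exact ind_true hl.symm
      · intro l' _ hl'
        exact ind_false fun h => hl' ((hy.strictMono hq).injective (h.symm.trans hl.symm))
      · simp
    · refine Finset.sum_eq_zero fun l _ => ind_false fun hl => h ?_
      simp only [colorSet, Finset.mem_image, Finset.mem_univ, true_and]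
      exact ⟨l, hl.symm⟩
  have h2 : ∑ j ∈ Finset.range k, ∑ l ∈ Finset.range k, ind (digit q x j = digit q y l) =
      (colorSet q k x hq ∩ colorSet q k y hq).card := by
    have h3 : colorSet q k x hq ∩ colorSet q k y hq =
        (Finset.univ.filter fun j => digitFin q k x hq j ∈ colorSet q k y hq).image
          (digitFin q k x hq) := by
      ext c
      simp only [Finset.mem_inter, Finset.mem_image, Finset.mem_filter, Finset.mem_univ, true_and]
      constructor
      · rintro ⟨h4, h5⟩
        simp only [colorSet, Finset.mem_image, Finset.mem_univ, true_and] at h4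
        obtain ⟨j, rfl⟩ := h4
        exact ⟨j, h5, rfl⟩
      · rintro ⟨j, h4, rfl⟩
        exact ⟨by simp [colorSet], h4⟩
    rw [h3, Finset.card_image_of_injective _ (hx.strictMono hq).injective, Finset.card_filter,
      ← Finset.sum_congr rfl (fun j _ => h1 j), Finset.sum_range]
    refine Finset.sum_congr rfl fun j _ => ?_
    rw [Finset.sum_range]
    refine Finset.sum_congr rfl fun l _ => ind_congr ?_
    exact (Fin.ext_iff (a := digitFin q k x hq j) (b := digitFin q k y hq l)).symm
  rw [Compat, h2]

theorem exists_isCode {s : Finset (Fin q)} (hs : s.card = k) :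
    ∃ x < q ^ k, IsCode q k x ∧ colorSet q k x hq = s := by
  let e := s.orderEmbOfFin hs
  -- The inverse of `finFunctionFinEquiv` computes `x / q ^ j % q`, which is `digit` by definition.
  have hd : ∀ j : Fin k, digit q (finFunctionFinEquiv (fun j => e j)) j = e j := by
    intro j
    have := congrFun (finFunctionFinEquiv.symm_apply_apply (fun j => e j)) j
    exact congrArg Fin.val this
  refine ⟨finFunctionFinEquiv (fun j => e j), Fin.is_lt _, ?_, ?_⟩
  · intro j hj
    have h1 := hd ⟨j, by omega⟩
    have h2 := hd ⟨j + 1, hj⟩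
    simp only at h1 h2
    rw [h1, h2]
    exact e.strictMono (Fin.mk_lt_mk.2 (Nat.lt_succ_self j))
  · have : digitFin q k (finFunctionFinEquiv (fun j => e j)) hq = e := by
      funext j
      exact Fin.ext (hd j)
    rw [colorSet, this]
    ext c
    simp [e]

theorem digit_injective {x y : ℕ} (hx : x < q ^ k) (hy : y < q ^ k)
    (h : digitFin q k x hq = digitFin q k y hq) : x = y := by
  have := (finFunctionFinEquiv (m := q) (n := k)).symm.injective
    (a₁ := ⟨x, hx⟩) (a₂ := ⟨y, hy⟩) (by
      funext j
      exact Fin.ext (congrArg Fin.val (congrFun h j)))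
  exact congrArg Fin.val this

-- A finite set has only one increasing enumeration, and a number below `q ^ k` is determined by its
-- `k` digits; so `colorSet` is a bijection from the codes to the `k`-subsets.
open Classical in
theorem card_isCode {q k : ℕ} (hq : 0 < q) :
    ((Finset.range (q ^ k)).filter (IsCode q k)).card = q.choose k := by
  rw [← Finset.card_fin q, ← Finset.card_powersetCard, Finset.card_fin]
  refine Finset.card_bij (fun x _ => colorSet q k x hq) ?_ ?_ ?_
  · intro x hx
    simp only [Finset.mem_filter, Finset.mem_range] at hx
    simp [Finset.mem_powersetCard, hx.2.card_colorSet hq]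
  · intro x hx y hy hxy
    simp only [Finset.mem_filter, Finset.mem_range] at hx hy
    refine digit_injective hq hx.1 hy.1 ?_
    have h1 := Finset.orderEmbOfFin_unique (hx.2.card_colorSet hq)
      (f := digitFin q k x hq) (by simp [colorSet]) (hx.2.strictMono hq)
    have h2 := Finset.orderEmbOfFin_unique (hx.2.card_colorSet hq)
      (f := digitFin q k y hq) (by rw [hxy]; simp [colorSet]) (hy.2.strictMono hq)
    rw [h1, h2]
  · intro s hs
    obtain ⟨x, hx, h1, h2⟩ := exists_isCode hq (Finset.mem_powersetCard.1 hs).2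
    exact ⟨x, by simp [hx, h1], h2⟩

/-- From `1 ≤ k ≤ q` one gets `q ≤ k * (q + 1 - k)`, and `(q + 1 - k) ^ k` is at most the descending
factorial, which is `k!` times the binomial coefficient. This converts bounds in `q ^ k` into bounds
in `q.choose k`. -/
theorem pow_le_mul_choose (hk : 1 ≤ k) (hkq : k ≤ q) :
    q ^ k ≤ k ^ k * k.factorial * q.choose k := by
  have h1 : q ≤ k * (q + 1 - k) := by
    obtain ⟨m, rfl⟩ := Nat.exists_eq_add_of_le hkq
    rw [show k + m + 1 - k = m + 1 by omega]
    nlinarith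
  calc q ^ k ≤ (k * (q + 1 - k)) ^ k := Nat.pow_le_pow_left h1 k
    _ = k ^ k * (q + 1 - k) ^ k := mul_pow _ _ _
    _ ≤ k ^ k * q.descFactorial k := Nat.mul_le_mul_left _ (Nat.pow_sub_le_descFactorial q k)
    _ = _ := by rw [Nat.descFactorial_eq_factorial_mul_choose]; ring

/-- `h` gives compatible codes to the ends of the edges of a graph on the vertices `v < n`. -/
def IsCodeColoring (adj : ℕ → ℕ → Prop) (n q k i : ℕ) (h : ℕ → ℕ) : Prop :=
  (∀ v < n, h v < q ^ k ∧ IsCode q k (h v)) ∧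
    ∀ u < n, ∀ v < n, adj u v → Compat q k i (h u) (h v)

/-- Adjacency of `G` as a relation of natural numbers. -/
def natAdj {n : ℕ} (G : SimpleGraph (Fin n)) (u v : ℕ) : Prop :=
  ∃ (hu : u < n) (hv : v < n), G.Adj ⟨u, hu⟩ ⟨v, hv⟩

/-- Membership in `S` as a predicate on natural numbers. -/
def natMem {n : ℕ} (S : Finset (Fin n)) (v : ℕ) : Prop := ∃ hv : v < n, (⟨v, hv⟩ : Fin n) ∈ S

theorem qkiColorable_iff {q k i : ℕ} (hq : 0 < q) {n : ℕ} (G : SimpleGraph (Fin n)) :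
    QKIColorable G q k i ↔ ∃ h, IsCodeColoring (natAdj G) n q k i h := by
  constructor
  · rintro ⟨h, h1, h2⟩
    choose f hf hc he using fun v => exists_isCode hq (h1 v)
    refine ⟨fun v => if hv : v < n then f ⟨v, hv⟩ else 0, ?_, ?_⟩
    · intro v hv
      simp [hv, hf, hc]
    · rintro u hu v hv ⟨_, _, huv⟩
      simp only [hu, hv, dite_true]
      rw [(hc _).compat_iff hq (hc _), he, he]
      exact h2 _ _ huv
  · rintro ⟨h, h1, h2⟩
    refine ⟨fun v => colorSet q k (h v) hq, ?_, ?_⟩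
    · intro v
      exact (h1 v v.2).2.card_colorSet hq
    · intro u v huv
      rw [← (h1 u u.2).2.compat_iff hq (h1 v v.2).2]
      exact h2 u u.2 v v.2 ⟨u.2, v.2, huv⟩

end Codes

/-! ### Acyclic graphs -/

/-- A connected component is a tree. It has a vertex of degree one or is a single vertex, and
neighbors never leave the component. -/
theorem SimpleGraph.IsAcyclic.exists_subsingleton_neighborSet {V : Type*} [Finite V] [Nonempty V]
    {G : SimpleGraph V} (hG : G.IsAcyclic) : ∃ v, (G.neighborSet v).Subsingleton := by
  classical
  have := Fintype.ofFinite V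
  obtain ⟨v₀⟩ := ‹Nonempty V›
  let c := G.connectedComponentMk v₀
  have hc : c.toSimpleGraph.IsTree := hG.isTree_connectedComponent c
  have key : ∀ v : c, (c.toSimpleGraph.neighborSet v).Subsingleton →
      (G.neighborSet (v : V)).Subsingleton := by
    intro v hv a ha b hb
    have mem : ∀ x, G.Adj v x → x ∈ c := fun x hx => by
      have h1 : G.connectedComponentMk (v : V) = c := v.2
      have h2 : G.connectedComponentMk x = c :=
        (SimpleGraph.ConnectedComponent.sound hx.reachable.symm).trans h1
      exact h2
    have := @hv ⟨a, mem a ha⟩ ha ⟨b, mem b hb⟩ hb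
    exact congrArg Subtype.val this
  by_cases hn : Nontrivial c
  · obtain ⟨v, hv⟩ := hc.exists_vert_degree_one_of_nontrivial
    refine ⟨v, key v ?_⟩
    obtain ⟨u, _, hu⟩ := SimpleGraph.degree_eq_one_iff_existsUnique_adj.1 hv
    intro a ha b hb
    rw [hu a ha, hu b hb]
  · rw [not_nontrivial_iff_subsingleton] at hn
    exact ⟨v₀, key ⟨v₀, rfl⟩ (Set.subsingleton_of_subsingleton)⟩

/-- Adjacency after the removal of all edges at `S`. -/
def forestAdj (adj : ℕ → ℕ → Prop) (mem : ℕ → Prop) (u v : ℕ) : Prop :=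
  adj u v ∧ ¬mem u ∧ ¬mem v

/-- Each nonempty set of vertices has a vertex with at most one neighbor in that set. -/
def IsForest (n : ℕ) (H : ℕ → ℕ → Prop) : Prop :=
  ∀ R : ℕ → Prop, (∃ v < n, ¬R v) →
    ∃ v < n, ¬R v ∧ ∀ u < n, ∀ u' < n, H v u → ¬R u → H v u' → ¬R u' → u = u'

/-- This is the only form in which acyclicity enters the algorithm; `R` will be the set of
eliminated vertices. Vertices of `S` remain present, but isolated. -/
theorem IsFeedbackVertexSet.isForest {n : ℕ} {G : SimpleGraph (Fin n)} {S : Finset (Fin n)}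
    (h : IsFeedbackVertexSet G S) : IsForest n (forestAdj (natAdj G) (natMem S)) := by
  rintro R ⟨v₀, hv₀, hR₀⟩
  by_cases hS : ∀ v : Fin n, ¬R v → v ∈ S
  · refine ⟨v₀, hv₀, hR₀, fun u _ u' _ hu => ?_⟩
    exact absurd ⟨hv₀, hS ⟨v₀, hv₀⟩ hR₀⟩ hu.2.1
  · push Not at hS
    obtain ⟨v₁, hv₁, hS₁⟩ := hS
    -- The remaining vertices outside `S`. The induced graph is again acyclic, and forest edges lead
    -- nowhere else among the remaining vertices.
    let A : Set ((S : Set (Fin n))ᶜ : Set (Fin n)) := {v | ¬R (v : Fin n)}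
    have hA : ((G.induce (S : Set (Fin n))ᶜ).induce A).IsAcyclic := h.induce A
    have : Nonempty A := ⟨⟨⟨v₁, by simpa using hS₁⟩, hv₁⟩⟩
    obtain ⟨⟨⟨v, hvS⟩, hvR⟩, hv⟩ := hA.exists_subsingleton_neighborSet
    refine ⟨v, v.2, hvR, ?_⟩
    rintro u hu u' hu' ⟨⟨_, _, h1⟩, _, h2⟩ h3 ⟨⟨_, _, h4⟩, _, h5⟩ h6
    have h2' : (⟨u, hu⟩ : Fin n) ∈ ((S : Set (Fin n))ᶜ : Set (Fin n)) := fun h => h2 ⟨hu, h⟩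
    have h5' : (⟨u', hu'⟩ : Fin n) ∈ ((S : Set (Fin n))ᶜ : Set (Fin n)) := fun h => h5 ⟨hu', h⟩
    have := @hv ⟨⟨⟨u, hu⟩, h2'⟩, h3⟩ h1 ⟨⟨⟨u', hu'⟩, h5'⟩, h6⟩ h4
    simpa using this

/-- A forest is 2-colorable, each vertex of `S` receives a private color, and each color is then
blown up to a block of `k` colors. Distinct blocks are disjoint, so the bound holds for every `i`.
-/
theorem IsFeedbackVertexSet.qkiColorable {n : ℕ} {G : SimpleGraph (Fin n)} {S : Finset (Fin n)}
    (h : IsFeedbackVertexSet G S) (k i : ℕ) : QKIColorable G (k * (S.card + 2)) k i := by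
  classical
  obtain ⟨C⟩ := h.colorable_two
  -- a proper coloring with `|S| + 2` colors
  obtain ⟨g, hg⟩ : ∃ g : Fin n → Fin (S.card + 2), ∀ u v, G.Adj u v → g u ≠ g v := by
    refine ⟨fun v => if hv : v ∈ S then (S.equivFin ⟨v, hv⟩).castAdd 2
      else (C ⟨v, by simpa using hv⟩).natAdd S.card, ?_⟩
    intro u v huv
    by_cases hu : u ∈ S <;> by_cases hv : v ∈ S <;> simp only [hu, hv, dite_true, dite_false]
    · intro h
      have := S.equivFin.injective (Fin.castAdd_injective _ _ h)
      exact huv.ne (congrArg Subtype.val this)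
    · intro h
      have := congrArg Fin.val h
      simp only [Fin.val_castAdd, Fin.val_natAdd] at this
      omega
    · intro h
      have := congrArg Fin.val h
      simp only [Fin.val_castAdd, Fin.val_natAdd] at this
      omega
    · intro h
      have h1 := Fin.natAdd_injective _ _ h
      exact C.valid (v := ⟨u, by simpa using hu⟩) (w := ⟨v, by simpa using hv⟩) (by simpa using huv) h1
  -- The block of the color `g v` consists of the pairs `(j, g v)`, numbered by `finProdFinEquiv`.
  refine ⟨fun v => Finset.univ.image (fun j : Fin k => finProdFinEquiv (j, g v)), ?_, ?_⟩
  · intro v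
    rw [Finset.card_image_of_injective _ (fun a b hab => by simpa using hab)]
    simp
  · intro u v huv
    rw [Finset.card_eq_zero.2]
    · exact Nat.zero_le _
    · rw [← Finset.disjoint_iff_inter_eq_empty, Finset.disjoint_left]
      intro c hc hc'
      simp only [Finset.mem_image, Finset.mem_univ, true_and] at hc hc'
      obtain ⟨j, rfl⟩ := hc
      obtain ⟨l, hl⟩ := hc'
      have := finProdFinEquiv.injective hl
      exact hg u v huv (congrArg Prod.snd this).symm

/-! ### Expressions of the decision program

Register `1` holds `q`, register `2` holds `n` and register `3` holds `q ^ k`. In the work memory,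
cell `v` holds the code chosen for the vertex `v` of the feedback vertex set, cell `n + v` tells
whether `v` has been eliminated, and cell `2 n + v q ^ k + x` tells whether the code `x` is still
allowed for `v`. The graph starts at position `o` of the input. -/

/-- The machine has the instance in its input, and its words and cells are large enough. -/
structure Fit (M : WMachine) (o n q k i K : ℕ) (adj : ℕ → ℕ → Prop) (mem : ℕ → Prop) : Prop where
  n_pos : 1 ≤ n
  k_pos : 1 ≤ k
  k_le : k ≤ q
  pow_eq : q ^ k = K
  input_n : M.input.getD o 0 = n
  input_mem : ∀ v < n, M.input.getD (o + 1 + v) 0 = ind (mem v)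
  input_adj : ∀ u < n, ∀ v < n, M.input.getD (o + 1 + (n + (u * n + v))) 0 = ind (adj u v)
  word_input : o + 1 + (n + n * n) < 2 ^ M.w
  word_mem : n + n + n * K + 2 < 2 ^ M.w
  word_const : k * k + i + 2 < 2 ^ M.w
  cell_code : ∀ v < n, ∃ h : v < M.cells.length, K ≤ 2 ^ M.cells[v]
  cell_removed : ∀ v < n, ∃ h : n + v < M.cells.length, 1 ≤ M.cells[n + v]
  cell_table : ∀ v < n, ∀ x < K, ∃ h : n + n + (v * K + x) < M.cells.length,
    1 ≤ M.cells[n + n + (v * K + x)]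

/-- The registers that hold the size parameters. -/
structure Base (n q K : ℕ) (σ : WState) : Prop where
  reg_q : σ.regs 1 = q
  reg_n : σ.regs 2 = n
  reg_K : σ.regs 3 = K

theorem Base.congr {n q K : ℕ} {σ τ : WState} (h : Base n q K σ)
    (h1 : τ.regs 1 = σ.regs 1) (h2 : τ.regs 2 = σ.regs 2) (h3 : τ.regs 3 = σ.regs 3) :
    Base n q K τ := ⟨h1.trans h.reg_q, h2.trans h.reg_n, h3.trans h.reg_K⟩

theorem row_lt {v n x K : ℕ} (hv : v < n) (hx : x < K) : v * K + x < n * K := by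
  have : (v + 1) * K ≤ n * K := Nat.mul_le_mul_right K hv
  rw [Nat.add_mul] at this
  omega

/-- Uniqueness of division with remainder: different entries of the table have different addresses,
so a store affects only one entry. -/
theorem row_inj {v v' x x' K : ℕ} (hx : x < K) (hx' : x' < K) :
    v * K + x = v' * K + x' ↔ v = v' ∧ x = x' := by
  constructor
  · intro h
    have h1 : (v * K + x) / K = v := by
      rw [mul_comm, Nat.mul_add_div (by omega), Nat.div_eq_of_lt hx, add_zero]
    have h2 : (v' * K + x') / K = v' := by
      rw [mul_comm, Nat.mul_add_div (by omega), Nat.div_eq_of_lt hx', add_zero]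
    have h3 : v = v' := by rw [← h1, h, h2]
    subst h3
    exact ⟨rfl, by omega⟩
  · rintro ⟨rfl, rfl⟩
    rfl

/-- Membership of a vertex in the feedback vertex set. -/
def memE (o : ℕ) (v : WExpr) : WExpr := .input (.op .add (.lit (o + 1)) v)

/-- Adjacency of two vertices. -/
def adjE (o : ℕ) (u v : WExpr) : WExpr :=
  .input (.op .add (.lit (o + 1)) (.op .add (.reg 2) (.op .add (.op .mul u (.reg 2)) v)))

/-- Adjacency of two vertices outside the feedback vertex set. -/
def forestE (o : ℕ) (u v : WExpr) : WExpr :=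
  .op .mul (adjE o u v) (.op .mul (memE o u).neg (memE o v).neg)

/-- The address of the elimination bit of a vertex. -/
def removedA (v : WExpr) : WExpr := .op .add (.reg 2) v

/-- The address of a table bit. -/
def tableA (v x : WExpr) : WExpr :=
  .op .add (.op .add (.reg 2) (.reg 2)) (.op .add (.op .mul v (.reg 3)) x)

/-- A digit in base `q`. -/
def digitE (e : WExpr) (j : ℕ) : WExpr :=
  .op .mod (.op .div e (WExpr.pow (.reg 1) j)) (.reg 1)

/-- Compatibility of two codes. -/
def compatE (k i : ℕ) (e f : WExpr) : WExpr :=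
  .op .lt (WExpr.sum (fun j => WExpr.sum (fun l => .op .eq (digitE e j) (digitE f l)) k) k)
    (.lit (i + 1))

/-- The test whether a number is a code. -/
def codeE (k : ℕ) (e : WExpr) : WExpr :=
  .op .eq (WExpr.sum (fun j => (WExpr.op .lt (digitE e j) (digitE e (j + 1))).neg) (k - 1))
    (.lit 0)

/-! ### Values and legality of the expressions under the size assumptions -/

section Expressions

variable {M : WMachine} {o n q k i K : ℕ} {adj : ℕ → ℕ → Prop} {mem : ℕ → Prop}
  {σ : WState}

theorem Fit.q_pos (hM : Fit M o n q k i K adj mem) : 1 ≤ q := hM.k_pos.trans hM.k_le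

theorem Fit.K_pos (hM : Fit M o n q k i K adj mem) : 1 ≤ K :=
  hM.pow_eq ▸ Nat.one_le_pow _ _ hM.q_pos

theorem Fit.two_lt (hM : Fit M o n q k i K adj mem) : 2 < 2 ^ M.w :=
  lt_of_le_of_lt (by omega) hM.word_mem

theorem Fit.one_lt (hM : Fit M o n q k i K adj mem) : 1 < 2 ^ M.w := by
  have := hM.two_lt; omega

theorem Fit.K_lt (hM : Fit M o n q k i K adj mem) : K + 2 < 2 ^ M.w := by
  have := hM.word_mem
  have : 1 * K ≤ n * K := Nat.mul_le_mul_right K hM.n_pos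
  omega

theorem Fit.n_lt (hM : Fit M o n q k i K adj mem) : n + 2 < 2 ^ M.w := by
  have := hM.word_mem
  omega

theorem Fit.q_le (hM : Fit M o n q k i K adj mem) : q ≤ K := by
  rw [← hM.pow_eq]
  exact Nat.le_self_pow (by have := hM.k_pos; omega) q

theorem Fit.val_n (hM : Fit M o n q k i K adj mem) (hB : Base n q K σ) :
    (WExpr.reg 2).HasVal M σ n := .reg hB.reg_n (by have := hM.n_lt; omega)

theorem Fit.val_K (hM : Fit M o n q k i K adj mem) (hB : Base n q K σ) :
    (WExpr.reg 3).HasVal M σ K := .reg hB.reg_K (by have := hM.K_lt; omega)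

theorem Fit.val_q (hM : Fit M o n q k i K adj mem) (hB : Base n q K σ) :
    (WExpr.reg 1).HasVal M σ q := .reg hB.reg_q (by have := hM.K_lt; have := hM.q_le; omega)

theorem Fit.val_ind (hM : Fit M o n q k i K adj mem) {x : ℕ} {p : Prop} (h : σ.regs x = ind p) :
    (WExpr.reg x).HasVal M σ (ind p) := .reg h ((ind_le_one p).trans_lt hM.one_lt)

theorem Fit.val_mem (hM : Fit M o n q k i K adj mem) {e : WExpr} {v : ℕ}
    (he : e.HasVal M σ v) (hv : v < n) : (memE o e).HasVal M σ (ind (mem v)) :=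
  .input (.add (.lit (by have := hM.word_input; omega)) he (by have := hM.word_input; omega))
    (hM.input_mem v hv) ((ind_le_one _).trans_lt hM.one_lt)

theorem Fit.val_adj (hM : Fit M o n q k i K adj mem) (hB : Base n q K σ) {e f : WExpr} {u v : ℕ}
    (he : e.HasVal M σ u) (hf : f.HasVal M σ v) (hu : u < n) (hv : v < n) :
    (adjE o e f).HasVal M σ (ind (adj u v)) := by
  have h1 := row_lt hu hv
  have h2 := hM.word_input
  exact .input (.add (.lit (by omega)) (.add (hM.val_n hB) (.add (.mul he (hM.val_n hB) (by omega))
    hf (by omega)) (by omega)) (by omega)) (hM.input_adj u hu v hv)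
    ((ind_le_one _).trans_lt hM.one_lt)

theorem Fit.val_forest (hM : Fit M o n q k i K adj mem) (hB : Base n q K σ) {e f : WExpr} {u v : ℕ}
    (he : e.HasVal M σ u) (hf : f.HasVal M σ v) (hu : u < n) (hv : v < n) :
    (forestE o e f).HasVal M σ (ind (forestAdj adj mem u v)) :=
  .mul_ind (hM.val_adj hB he hf hu hv) (.mul_ind ((hM.val_mem he hu).neg hM.one_lt)
    ((hM.val_mem hf hv).neg hM.one_lt) hM.one_lt) hM.one_lt

theorem Fit.val_removedA (hM : Fit M o n q k i K adj mem) (hB : Base n q K σ) {e : WExpr} {v : ℕ}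
    (he : e.HasVal M σ v) (hv : v < n) : (removedA e).HasVal M σ (n + v) :=
  .add (hM.val_n hB) he (by have := hM.word_mem; omega)

theorem Fit.val_tableA (hM : Fit M o n q k i K adj mem) (hB : Base n q K σ) {e f : WExpr}
    {v x : ℕ} (he : e.HasVal M σ v) (hf : f.HasVal M σ x) (hv : v < n) (hx : x < K) :
    (tableA e f).HasVal M σ (n + n + (v * K + x)) := by
  have h1 := row_lt hv hx
  have h2 := hM.word_mem
  exact .add (.add (hM.val_n hB) (hM.val_n hB) (by omega)) (.add (.mul he (hM.val_K hB) (by omega))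
    hf (by omega)) (by omega)

theorem Fit.val_digit (hM : Fit M o n q k i K adj mem) (hB : Base n q K σ) {e : WExpr} {x j : ℕ}
    (he : e.HasVal M σ x) (hj : j ≤ k) : (digitE e j).HasVal M σ (digit q x j) := by
  refine .mod (.div he (.pow hM.q_pos (hM.val_q hB) ?_)) (hM.val_q hB)
  -- The divisor has to fit into a word; this is why `j` is limited to `k`.
  have h1 : q ^ j ≤ q ^ k := Nat.pow_le_pow_right hM.q_pos hj
  have := hM.K_lt
  rw [hM.pow_eq] at h1
  omega

theorem Fit.val_compat (hM : Fit M o n q k i K adj mem) (hB : Base n q K σ) {e f : WExpr}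
    {x y : ℕ} (he : e.HasVal M σ x) (hf : f.HasVal M σ y) :
    (compatE k i e f).HasVal M σ (ind (Compat q k i x y)) := by
  have hw := hM.word_const
  have h1 : ∀ j, ∑ l ∈ Finset.range k, ind (digit q x j = digit q y l) ≤ k := fun j =>
    (Finset.sum_le_card_nsmul _ _ 1 (fun l _ => ind_le_one _)).trans (by simp)
  have h2 : ∑ j ∈ Finset.range k, ∑ l ∈ Finset.range k, ind (digit q x j = digit q y l) ≤ k * k :=
    (Finset.sum_le_card_nsmul _ _ k (fun j _ => h1 j)).trans (by simp)
  have h3 : k ≤ k * k := Nat.le_mul_self k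
  refine (WExpr.HasVal.lt_ind (.sum (fun j hj => .sum (fun l hl => .eq_ind
    (hM.val_digit hB he hj.le) (hM.val_digit hB hf hl.le) hM.one_lt) ?_) ?_)
    (.lit (by omega)) hM.one_lt).congr (ind_congr Nat.lt_succ_iff)
  · have := h1 j
    omega
  · omega

theorem Fit.val_code (hM : Fit M o n q k i K adj mem) (hB : Base n q K σ) {e : WExpr}
    {x : ℕ} (he : e.HasVal M σ x) : (codeE k e).HasVal M σ (ind (IsCode q k x)) := by
  have hw := hM.word_const
  have h1 : ∑ j ∈ Finset.range (k - 1), ind (¬digit q x j < digit q x (j + 1)) ≤ k - 1 :=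
    (Finset.sum_le_card_nsmul _ _ 1 (fun l _ => ind_le_one _)).trans (by simp)
  have h3 : k ≤ k * k := Nat.le_mul_self k
  refine (WExpr.HasVal.eq_ind (.sum (fun j hj => (WExpr.HasVal.lt_ind
    (hM.val_digit hB he (by omega)) (hM.val_digit hB he (by omega)) hM.one_lt).neg hM.one_lt) ?_)
    (.lit (by omega)) hM.one_lt).congr (ind_congr ?_)
  · omega
  · rw [Finset.sum_eq_zero_iff]
    simp only [Finset.mem_range, ind_eq_zero, not_not, IsCode]
    exact forall_congr' fun j => ⟨fun h hj => h (by omega), fun h hj => h (by omega)⟩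

end Expressions

/-- The work memory holds the codes `a`, the elimination bits `R` and the tables `F`. -/
structure Holds (n K : ℕ) (m : ℕ → ℕ) (a : ℕ → ℕ) (R : ℕ → Prop) (F : ℕ → ℕ → Prop) : Prop where
  code : ∀ v < n, m v = a v
  removed : ∀ v < n, m (n + v) = ind (R v)
  table : ∀ v < n, ∀ x < K, m (n + n + (v * K + x)) = ind (F v x)

/-! ### Reading and writing the work memory -/

section Memory

variable {M : WMachine} {o n q k i K : ℕ} {adj : ℕ → ℕ → Prop} {mem : ℕ → Prop}
  {σ : WState} {a : ℕ → ℕ} {R : ℕ → Prop} {F : ℕ → ℕ → Prop}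

/-- The updated table is written as a propositional disjunction, so that loop invariants can be
restored by `Holds.congr` and propositional reasoning. -/
theorem Holds.setTable (h : Holds n K σ.mem a R F) {v x : ℕ} (hx : x < K) (p : Prop) :
    Holds n K (σ.setMem (n + n + (v * K + x)) (ind p)).mem a R
      (fun v' x' => (v' = v ∧ x' = x ∧ p) ∨ (¬(v' = v ∧ x' = x) ∧ F v' x')) := by
  refine ⟨fun v' hv' => ?_, fun v' hv' => ?_, fun v' hv' x' hx' => ?_⟩
  · rw [WState.setMem_mem, if_neg (by omega), h.code v' hv']
  · rw [WState.setMem_mem, if_neg (by omega), h.removed v' hv']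
  · rw [WState.setMem_mem]
    simp only [Nat.add_left_cancel_iff, row_inj hx' hx]
    split_ifs with h1
    · exact ind_congr (by tauto)
    · rw [h.table v' hv' x' hx']
      exact ind_congr (by tauto)

theorem Holds.setRemoved (h : Holds n K σ.mem a R F) {v : ℕ} (hv : v < n) (p : Prop) :
    Holds n K (σ.setMem (n + v) (ind p)).mem a (fun v' => (v' = v ∧ p) ∨ (v' ≠ v ∧ R v')) F := by
  refine ⟨fun v' hv' => ?_, fun v' hv' => ?_, fun v' hv' x' hx' => ?_⟩
  · rw [WState.setMem_mem, if_neg (by omega), h.code v' hv']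
  · rw [WState.setMem_mem]
    simp only [Nat.add_left_cancel_iff]
    split_ifs with h1
    · exact ind_congr (by tauto)
    · rw [h.removed v' hv']
      exact ind_congr (by tauto)
  · rw [WState.setMem_mem, if_neg (by omega), h.table v' hv' x' hx']

theorem Fit.val_load_code (hM : Fit M o n q k i K adj mem) (h : ∀ v < n, σ.mem v = a v)
    (ha : ∀ v < n, a v < K) {e : WExpr} {v : ℕ} (he : e.HasVal M σ v) (hv : v < n) :
    (WExpr.load e).HasVal M σ (a v) :=
  .load he (hM.cell_code v hv).1 (h v hv)
    (by have := ha v hv; have := hM.K_lt; omega)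

theorem Fit.val_removed (hM : Fit M o n q k i K adj mem) (hB : Base n q K σ)
    (h : Holds n K σ.mem a R F) {e : WExpr} {v : ℕ} (he : e.HasVal M σ v) (hv : v < n) :
    (WExpr.load (removedA e)).HasVal M σ (ind (R v)) :=
  .load (hM.val_removedA hB he hv) (hM.cell_removed v hv).1 (h.removed v hv)
    ((ind_le_one _).trans_lt hM.one_lt)

theorem Fit.val_table (hM : Fit M o n q k i K adj mem) (hB : Base n q K σ)
    (h : Holds n K σ.mem a R F) {e f : WExpr} {v x : ℕ} (he : e.HasVal M σ v)
    (hf : f.HasVal M σ x) (hv : v < n) (hx : x < K) :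
    (WExpr.load (tableA e f)).HasVal M σ (ind (F v x)) :=
  .load (hM.val_tableA hB he hf hv hx) (hM.cell_table v hv x hx).1 (h.table v hv x hx)
    ((ind_le_one _).trans_lt hM.one_lt)

theorem ind_lt_two_pow (p : Prop) {b : ℕ} (hb : 1 ≤ b) : ind p < 2 ^ b := by
  have h1 := ind_le_one p
  have h2 : 2 ^ 1 ≤ 2 ^ b := Nat.pow_le_pow_right (by omega) hb
  omega

theorem Fit.store_table (hM : Fit M o n q k i K adj mem) (hB : Base n q K σ) {e f g : WExpr}
    {v x : ℕ} {p : Prop} (he : e.HasVal M σ v) (hf : f.HasVal M σ x) (hv : v < n) (hx : x < K)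
    (hg : g.HasVal M σ (ind p)) {Q : WState → Prop}
    (hQ : Q (σ.setMem (n + n + (v * K + x)) (ind p))) :
    (WProg.store (tableA e f) g).Runs M σ ((tableA e f).cost + g.cost + 1) Q := by
  obtain ⟨h1, h2⟩ := hM.cell_table v hv x hx
  exact .store (hM.val_tableA hB he hf hv hx) hg h1 (ind_lt_two_pow _ h2) hQ

theorem Fit.store_removed (hM : Fit M o n q k i K adj mem) (hB : Base n q K σ) {e g : WExpr}
    {v : ℕ} {p : Prop} (he : e.HasVal M σ v) (hv : v < n)
    (hg : g.HasVal M σ (ind p)) {Q : WState → Prop} (hQ : Q (σ.setMem (n + v) (ind p))) :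
    (WProg.store (removedA e) g).Runs M σ ((removedA e).cost + g.cost + 1) Q := by
  obtain ⟨h1, h2⟩ := hM.cell_removed v hv
  exact .store (hM.val_removedA hB he hv) hg h1 (ind_lt_two_pow _ h2) hQ

theorem Fit.store_code (hM : Fit M o n q k i K adj mem) {e g : WExpr}
    {v x : ℕ} (he : e.HasVal M σ v) (hv : v < n) (hx : x < K)
    (hg : g.HasVal M σ x) {Q : WState → Prop} (hQ : Q (σ.setMem v x)) :
    (WProg.store e g).Runs M σ (e.cost + g.cost + 1) Q := by
  obtain ⟨h1, h2⟩ := hM.cell_code v hv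
  exact .store he hg h1 (by omega) hQ

end Memory

/-! ### Building blocks of the decision program -/

theorem le_mul_of_one_le (a : ℕ) {A : ℕ} (hA : 1 ≤ A) : a ≤ a * A := Nat.le_mul_of_pos_right a hA

/-- The bookkeeping rule for sequential composition: over a common monomial `A` the constants add.
-/
theorem add_le_add_mul {x y a b A : ℕ} (hx : x ≤ a * A) (hy : y ≤ b * A) : x + y ≤ (a + b) * A := by
  rw [Nat.add_mul]; omega

/-- Register `9` becomes the truth value of `e` holding for all values of the counter `x`. -/
def allLoop (x y : ℕ) (e : WExpr) : WProg :=
  .seq (.assign 9 (.lit 1)) (.forLoop x y (.assign 9 (.op .mul (.reg 9) e)))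

/-- Register `9` accumulates a product of indicators. The value of `e` may depend on the counter and
on anything that the loop leaves alone, but not on the accumulator. -/
theorem allLoop_runs {M : WMachine} {σ : WState} {x y N B : ℕ} {e : WExpr} {p : ℕ → Prop}
    (hw : N + 1 < 2 ^ M.w) (hN : σ.regs y = N) (hx : x ≠ 9) (hy : y ≠ 9) (hxy : y ≠ x)
    (hB : 1 ≤ B) (hNB : N ≤ B)
    (he : ∀ j < N, ∀ τ : WState, τ.mem = σ.mem → τ.regs x = j →
      (∀ z, z ≠ 9 → z ≠ x → τ.regs z = σ.regs z) → e.HasVal M τ (ind (p j)))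
    (h1 : 1 < 2 ^ M.w) :
    (allLoop x y e).Runs M σ ((2 * e.cost + 40) * B) (fun τ => τ.regs 9 = ind (∀ j < N, p j) ∧
      τ.mem = σ.mem ∧ ∀ z, z ≠ 9 → z ≠ x → τ.regs z = σ.regs z) := by
  refine (WProg.Runs.seq (T' := (2 * (e.cost + 3) + 20) * (1 * B))
    (Q₁ := fun τ => τ = σ.setReg 9 1) (.assign (.lit h1) rfl) ?_).mono ?_ fun _ h => h
  · rintro _ rfl
    refine (WProg.Runs.forLoop (fun j τ => τ.regs 9 = ind (∀ l < j, p l) ∧ τ.mem = σ.mem)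
      (N := N) (by simp [hy, hN]) hw (p := .assign 9 _) hx hy hxy le_rfl hB
      hNB ?_ ?_).mono le_rfl ?_
    · simp [hx.symm, ind_true]
    · rintro j hj τ ⟨h2, h3⟩ h4 h5
      have h6 := he j hj τ h3 h4 (fun z hz hzx => by rw [h5 z hz hzx]; simp [hz])
      refine (WProg.Runs.assign (.mul_ind (.reg h2 ?_) h6 h1) ?_).mono ?_ fun _ h => h
      · exact (ind_le_one _).trans_lt h1
      · simp only [WState.setReg_regs, hx.symm, if_false, if_true, WState.setReg_mem]
        refine ⟨ind_congr ?_, h3⟩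
        simp only [Nat.forall_lt_succ_right]
      · simp only [WExpr.cost]
        omega
    · rintro τ ⟨⟨h2, h3⟩, h4⟩
      refine ⟨h2, h3, fun z hz hzx => ?_⟩
      rw [h4 z hz hzx]
      simp [hz]
  · simp only [WExpr.cost]
    have : (2 * (e.cost + 3) + 20) * (1 * B) = 2 * (e.cost * B) + 26 * B := by ring
    rw [this, show (2 * e.cost + 40) * B = 2 * (e.cost * B) + 40 * B by ring]
    omega

theorem keeps_allLoop {x y z : ℕ} {e : WExpr} : (allLoop x y e).Keeps z ↔ z ≠ x ∧ z ≠ 9 := by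
  simp only [allLoop, WProg.keeps_forLoop, WProg.Keeps]; tauto

/-- Register `9` becomes the sum of `e` over all values of the counter `x`. -/
def sumLoop (x y : ℕ) (e : WExpr) : WProg :=
  .seq (.assign 9 (.lit 0)) (.forLoop x y (.assign 9 (.op .add (.reg 9) e)))

theorem keeps_sumLoop {x y z : ℕ} {e : WExpr} : (sumLoop x y e).Keeps z ↔ z ≠ x ∧ z ≠ 9 := by
  simp only [sumLoop, WProg.keeps_forLoop, WProg.Keeps]; tauto

theorem sum_ind_le (p : ℕ → Prop) (N : ℕ) : ∑ j ∈ Finset.range N, ind (p j) ≤ N :=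
  (Finset.sum_le_card_nsmul _ _ 1 (fun l _ => ind_le_one _)).trans (by simp)

theorem sumLoop_runs {M : WMachine} {σ : WState} {x y N B : ℕ} {e : WExpr} {p : ℕ → Prop}
    (hw : N + 1 < 2 ^ M.w) (hN : σ.regs y = N) (hx : x ≠ 9) (hy : y ≠ 9) (hxy : y ≠ x)
    (hB : 1 ≤ B) (hNB : N ≤ B)
    (he : ∀ j < N, ∀ τ : WState, τ.mem = σ.mem → τ.regs x = j →
      (∀ z, z ≠ 9 → z ≠ x → τ.regs z = σ.regs z) → e.HasVal M τ (ind (p j))) :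
    (sumLoop x y e).Runs M σ ((2 * e.cost + 40) * B)
      (fun τ => τ.regs 9 = ∑ j ∈ Finset.range N, ind (p j) ∧
      τ.mem = σ.mem ∧ ∀ z, z ≠ 9 → z ≠ x → τ.regs z = σ.regs z) := by
  refine (WProg.Runs.seq (T' := (2 * (e.cost + 3) + 20) * (1 * B))
    (Q₁ := fun τ => τ = σ.setReg 9 0) (.assign (.lit (by omega)) rfl) ?_).mono ?_ fun _ h => h
  · rintro _ rfl
    refine (WProg.Runs.forLoop (fun j τ => τ.regs 9 = ∑ l ∈ Finset.range j, ind (p l) ∧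
      τ.mem = σ.mem) (N := N) (by simp [hy, hN]) hw (p := .assign 9 _) hx hy hxy le_rfl hB
      hNB ?_ ?_).mono le_rfl ?_
    · simp [hx.symm]
    · rintro j hj τ ⟨h2, h3⟩ h4 h5
      have h6 := he j hj τ h3 h4 (fun z hz hzx => by rw [h5 z hz hzx]; simp [hz])
      have h7 := sum_ind_le p j
      have h8 := ind_le_one (p j)
      refine (WProg.Runs.assign (.add (.reg h2 (by omega)) h6 (by omega)) ?_).mono ?_ fun _ h => h
      · simp only [WState.setReg_regs, hx.symm, if_false, if_true, WState.setReg_mem]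
        exact ⟨(Finset.sum_range_succ _ _).symm, h3⟩
      · simp only [WExpr.cost]
        omega
    · rintro τ ⟨⟨h2, h3⟩, h4⟩
      refine ⟨h2, h3, fun z hz hzx => ?_⟩
      rw [h4 z hz hzx]
      simp [hz]
  · simp only [WExpr.cost]
    have : (2 * (e.cost + 3) + 20) * (1 * B) = 2 * (e.cost * B) + 26 * B := by ring
    rw [this, show (2 * e.cost + 40) * B = 2 * (e.cost * B) + 40 * B by ring]
    omega

/-- Move register `8` to the next code. -/
def scanP (k : ℕ) : WProg :=
  .loop (.op .mul (.op .lt (.reg 8) (.reg 3)) (codeE k (.reg 8)).neg)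
    (.assign 8 (.op .add (.reg 8) (.lit 1)))

section Blocks

variable {M : WMachine} {o n q k i K : ℕ} {adj : ℕ → ℕ → Prop} {mem : ℕ → Prop}
  {σ : WState}

/-- The scan stops at the first code from `y₀` on, or at `K` if there is none; the value `K` later
signals a carry. -/
theorem Fit.scan_runs (hM : Fit M o n q k i K adj mem) (hB : Base n q K σ) {y₀ : ℕ}
    (h0 : σ.regs 8 = y₀) (hy₀ : y₀ ≤ K) :
    (scanP k).Runs M σ ((2 * (codeE k (.reg 8)).cost + 40) * K) (fun τ => τ.mem = σ.mem ∧
      ∃ y ≤ K, y₀ ≤ y ∧ τ.regs 8 = y ∧ (∀ z, y₀ ≤ z → z < y → ¬IsCode q k z) ∧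
        (y < K → IsCode q k y)) := by
  classical
  have hex : ∃ m, y₀ + m = K ∨ IsCode q k (y₀ + m) := ⟨K - y₀, Or.inl (by omega)⟩
  -- `N` is the number of rounds: the least distance from `y₀` to a code or to `K`.
  obtain ⟨N, hN, hmin⟩ : ∃ N, (y₀ + N = K ∨ IsCode q k (y₀ + N)) ∧
      ∀ m < N, ¬(y₀ + m = K ∨ IsCode q k (y₀ + m)) :=
    ⟨Nat.find hex, Nat.find_spec hex, fun m hm => Nat.find_min hex hm⟩
  have hNK : y₀ + N ≤ K := by
    by_contra h
    exact hmin (K - y₀) (by omega) (Or.inl (by omega))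
  have hw := hM.K_lt
  refine (WProg.Runs.loop (T := 4) (fun j τ => τ.mem = σ.mem ∧ τ.regs 8 = y₀ + j) (N := N)
    ⟨rfl, h0⟩ ?_ ?_).mono ?_ ?_
  · rintro j hj τ ⟨h1, h2⟩ h3
    have hB' : Base n q K τ := hB.congr (h3 1 (by simp [WProg.Keeps]))
      (h3 2 (by simp [WProg.Keeps])) (h3 3 (by simp [WProg.Keeps]))
    have hr : (WExpr.reg 8).HasVal M τ (y₀ + j) := .reg h2 (by omega)
    refine (WExpr.HasVal.mul_ind (.lt_ind hr (hM.val_K hB') hM.one_lt)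
      ((hM.val_code hB' hr).neg hM.one_lt) hM.one_lt).congr (ind_congr ?_)
    constructor
    · rintro ⟨h4, h5⟩
      by_contra h6
      obtain rfl : j = N := by omega
      rcases hN with h | h
      · omega
      · exact h5 h
    · intro h4
      exact ⟨by omega, fun h => hmin j h4 (Or.inr h)⟩
  · rintro j hj τ ⟨h1, h2⟩ h3
    exact .assign (.add (.reg h2 (by omega)) (.lit (by omega)) (by omega)) ⟨h1, by simp; omega⟩
  · simp only [WExpr.cost, WExpr.neg]
    have := hM.K_pos
    calc (N + 1) * _ ≤ (2 * K) * _ := Nat.mul_le_mul_right _ (by omega)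
      _ = (2 * (codeE k (.reg 8)).cost + 2 * (4 + (1 + 1 + 1 + (1 + 1) + 1) + 1)) * K := by ring
      _ ≤ _ := Nat.mul_le_mul_right _ (by omega)
  · rintro τ ⟨⟨h1, h2⟩, -⟩
    refine ⟨h1, y₀ + N, hNK, by omega, h2, ?_, ?_⟩
    · intro z hz hzN hc
      refine hmin (z - y₀) (by omega) (Or.inr ?_)
      rwa [show y₀ + (z - y₀) = z by omega]
    · intro h
      rcases hN with h' | h'
      · omega
      · exact h'

/-- The codes that are initially allowed for `v` when the feedback vertex set is colored by `a`. -/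
def initTable (adj : ℕ → ℕ → Prop) (mem : ℕ → Prop) (n q k i : ℕ) (a : ℕ → ℕ) (v x : ℕ) : Prop :=
  (∀ u < n, ¬((mem u ∧ adj u v) ∧ ¬Compat q k i (a u) x)) ∧ IsCode q k x ∧ ¬(mem v ∧ ¬x = a v)

/-- The first `r` elimination bits are cleared, and the tables are filled up to row `j`,
column `l`. -/
structure FilledTo (n K : ℕ) (m : ℕ → ℕ) (a : ℕ → ℕ) (F : ℕ → ℕ → Prop) (r j l : ℕ) : Prop where
  code : ∀ v < n, m v = a v
  removed : ∀ v < n, v < r → m (n + v) = 0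
  table : ∀ v < n, ∀ x < K, (v < j ∨ (v = j ∧ x < l)) → m (n + n + (v * K + x)) = ind (F v x)

/-- The expression tested by `fillP` for all vertices `u`. -/
def fillE (o k i : ℕ) : WExpr :=
  (WExpr.op .mul (.op .mul (memE o (.reg 6)) (adjE o (.reg 6) (.reg 5)))
    (compatE k i (.load (.reg 6)) (.reg 7)).neg).neg

/-- The value stored by `fillP`. -/
def fillV (o k : ℕ) : WExpr :=
  .op .mul (.reg 9) (.op .mul (codeE k (.reg 7))
    (WExpr.op .mul (memE o (.reg 5)) (WExpr.op .eq (.reg 7) (.load (.reg 5))).neg).neg)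

/-- Clear the elimination bits and fill the tables. -/
def fillP (o k i : ℕ) : WProg :=
  .forLoop 5 2 (.seq (.store (removedA (.reg 5)) (.lit 0))
    (.forLoop 7 3 (.seq (allLoop 6 2 (fillE o k i))
      (.store (tableA (.reg 5) (.reg 7)) (fillV o k)))))

theorem fill_runs (o k i : ℕ) : ∃ c, ∀ {M n q K adj mem σ},
    Fit M o n q k i K adj mem → Base n q K σ → ∀ a : ℕ → ℕ, (∀ v < n, σ.mem v = a v) →
    (∀ v < n, a v < K) →
    (fillP o k i).Runs M σ (c * (n * K * n)) (fun τ =>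
      Holds n K τ.mem a (fun _ => False) (initTable adj mem n q k i a)) := by
  -- The cost of the innermost body, a number depending on `o`, `k`, `i` only. Naming it through an
  -- equation keeps it an atom in the arithmetic below.
  obtain ⟨C, hC⟩ : ∃ C, C = 2 * (fillE o k i).cost + 40 +
    ((tableA (.reg 5) (.reg 7)).cost + (fillV o k).cost + 1) := ⟨_, rfl⟩
  refine ⟨2 * (5 + (2 * C + 20)) + 20, ?_⟩
  intro M n q K adj mem σ hM hB a ha haK
  have hn := hM.n_pos
  have hK := hM.K_pos
  have hnw := hM.n_lt
  have hKw := hM.K_lt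
  let F := initTable adj mem n q k i a
  refine (WProg.Runs.forLoop (fun j τ => FilledTo n K τ.mem a F j j 0) hB.reg_n
    (by omega) (by simp [WProg.Keeps, WProg.keeps_forLoop, keeps_allLoop])
    (by simp [WProg.Keeps, WProg.keeps_forLoop, keeps_allLoop]) (by simp) (A := n * K)
    (Nat.mul_pos hn hK) hn le_rfl ?_ ?_).mono le_rfl ?_
  · exact ⟨ha, fun v _ hv => absurd hv (by omega),
      fun v _ x _ h => absurd h (by omega)⟩
  · intro v hv τ hI hr hk
    have hB1 : Base n q K τ := hB.congr
      (hk 1 (by simp [WProg.Keeps, WProg.keeps_forLoop, keeps_allLoop]) (by simp))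
      (hk 2 (by simp [WProg.Keeps, WProg.keeps_forLoop, keeps_allLoop]) (by simp))
      (hk 3 (by simp [WProg.Keeps, WProg.keeps_forLoop, keeps_allLoop]) (by simp))
    have hv1 : (WExpr.reg 5).HasVal M τ v := .reg hr (by omega)
    refine (WProg.Runs.seq (hM.store_removed (p := False) hB1 hv1 hv
      ((WExpr.HasVal.lit (by omega)).congr (ind_false not_false).symm)
      (Q := fun τ' => τ' = τ.setMem (n + v) (ind False)) rfl) (T' := (2 * C + 20) * (n * K)) ?_).mono ?_
      fun _ h => h
    · rintro _ rfl
      refine (WProg.Runs.forLoop (fun l τ => FilledTo n K τ.mem a F (v + 1) v l)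
        (N := K) (by simpa using hB1.reg_K) (by omega) (by simp [WProg.Keeps, keeps_allLoop])
        (by simp [WProg.Keeps, keeps_allLoop]) (by simp) hn hK le_rfl ?_ ?_).mono le_rfl ?_
      · refine ⟨fun v' hv' => ?_, fun v' hv' h => ?_, fun v' hv' x hx h => ?_⟩
        · rw [WState.setReg_mem, WState.setMem_mem, if_neg (by omega), hI.code v' hv']
        · rw [WState.setReg_mem, WState.setMem_mem]
          split_ifs with h1
          · exact ind_false not_false
          · exact hI.removed v' hv' (by omega)
        · rw [WState.setReg_mem, WState.setMem_mem, if_neg (by omega)]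
          exact hI.table v' hv' x hx (by omega)
      · intro x hx ρ hJ hrx hk2
        have hB2 : Base n q K ρ := hB1.congr (hk2 1 (by simp [WProg.Keeps, keeps_allLoop])
          (by simp)) (hk2 2 (by simp [WProg.Keeps, keeps_allLoop]) (by simp))
          (hk2 3 (by simp [WProg.Keeps, keeps_allLoop]) (by simp))
        have hr5 : ρ.regs 5 = v :=
          (hk2 5 (by simp [WProg.Keeps, keeps_allLoop]) (by simp)).trans hr
        refine (WProg.Runs.seq (allLoop_runs (N := n) (B := n) (p := fun u =>
          ¬((mem u ∧ adj u v) ∧ ¬Compat q k i (a u) x)) (by omega) hB2.reg_n (by simp) (by simp)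
          (by simp) hn le_rfl ?_ hM.one_lt) (T' := (tableA (.reg 5) (.reg 7)).cost + (fillV o k).cost + 1)
          ?_).mono ?_ fun _ h => h
        rotate_left 1
        · rintro ρ' ⟨h9, hmem, hk3⟩
          have hB3 : Base n q K ρ' := hB2.congr (hk3 1 (by simp) (by simp))
            (hk3 2 (by simp) (by simp)) (hk3 3 (by simp) (by simp))
          have h5 : (WExpr.reg 5).HasVal M ρ' v :=
            .reg ((hk3 5 (by simp) (by simp)).trans hr5) (by omega)
          have h7 : (WExpr.reg 7).HasVal M ρ' x :=
            .reg ((hk3 7 (by simp) (by simp)).trans hrx) (by omega)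
          refine hM.store_table (p := F v x) hB3 h5 h7 hv hx (.mul_ind (hM.val_ind h9)
            (.mul_ind (hM.val_code hB3 h7) (WExpr.HasVal.neg (.mul_ind (hM.val_mem h5 hv)
              (WExpr.HasVal.neg (.eq_ind h7 (hM.val_load_code (a := a) ?_ haK h5 hv) hM.one_lt)
              hM.one_lt) hM.one_lt) hM.one_lt) hM.one_lt) hM.one_lt) ?_
          · rw [hmem]
            exact hJ.code
          · refine ⟨fun v' hv' => ?_, fun v' hv' h => ?_, fun v' hv' x' hx' h => ?_⟩
            · rw [WState.setReg_mem, WState.setMem_mem, if_neg (by omega), hmem,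
                hJ.code v' hv']
            · rw [WState.setReg_mem, WState.setMem_mem, if_neg (by omega), hmem,
                hJ.removed v' hv' h]
            · rw [WState.setReg_mem, WState.setMem_mem]
              simp only [Nat.add_left_cancel_iff, row_inj hx' hx]
              split_ifs with h1
              · rw [h1.1, h1.2]
              · rw [hmem]
                exact hJ.table v' hv' x' hx' (by omega)
        · rw [hC]
          exact add_le_add_mul le_rfl (le_mul_of_one_le _ hn)
        · intro u hu ρ' hmem hr6 hk3
          have hB3 : Base n q K ρ' := hB2.congr (hk3 1 (by simp) (by simp))
            (hk3 2 (by simp) (by simp)) (hk3 3 (by simp) (by simp))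
          have h5 : (WExpr.reg 5).HasVal M ρ' v :=
            .reg ((hk3 5 (by simp) (by simp)).trans hr5) (by omega)
          have h7 : (WExpr.reg 7).HasVal M ρ' x :=
            .reg ((hk3 7 (by simp) (by simp)).trans hrx) (by omega)
          have h6 : (WExpr.reg 6).HasVal M ρ' u := .reg hr6 (by omega)
          refine WExpr.HasVal.neg (.mul_ind (.mul_ind (hM.val_mem h6 hu)
            (hM.val_adj hB3 h6 h5 hu hv) hM.one_lt) (WExpr.HasVal.neg (hM.val_compat hB3
            (hM.val_load_code (a := a) ?_ haK h6 hu) h7) hM.one_lt) hM.one_lt) hM.one_lt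
          rw [hmem]
          exact hJ.code
      · rintro τ' ⟨h1, -⟩
        -- Row `v` filled up to column `K` is the same as all rows below `v + 1` filled and column
        -- `0` reached.
        refine ⟨h1.code, h1.removed, fun v' hv' x hx h => h1.table v' hv' x hx (by omega)⟩
    · exact add_le_add_mul (le_mul_of_one_le _ (Nat.mul_pos hn hK)) le_rfl
  · rintro τ ⟨h1, -⟩
    exact ⟨h1.code, fun v hv => (h1.removed v hv hv).trans (ind_false not_false).symm,
      fun v hv x hx => h1.table v hv x hx (Or.inl hv)⟩

end Blocks

/-! ### Elimination of the vertices of a forest -/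

/-- Translates the test of the program, a count below two, into the uniqueness statement used by
`IsLeaf`. -/
theorem sum_ind_lt_two {n : ℕ} {p : ℕ → Prop} :
    ∑ j ∈ Finset.range n, ind (p j) < 2 ↔ ∀ u < n, ∀ u' < n, p u → p u' → u = u' := by
  classical
  have h : ∑ j ∈ Finset.range n, ind (p j) = ((Finset.range n).filter p).card := by
    rw [Finset.card_filter]
    exact Finset.sum_congr rfl fun j _ => (ite_eq_ind _).symm
  rw [h, Nat.lt_succ_iff, Finset.card_le_one]
  simp only [Finset.mem_filter, Finset.mem_range]
  exact ⟨fun h u hu u' hu' hp hp' => h u ⟨hu, hp⟩ u' ⟨hu', hp'⟩,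
    fun h u hu u' hu' => h u hu.1 u' hu'.1 hu.2 hu'.2⟩

/-- There are codes from the tables `F` for all vertices that are compatible at all edges of `H`
between vertices outside `R`. -/
def Solvable (H : ℕ → ℕ → Prop) (n q k i K : ℕ) (R : ℕ → Prop) (F : ℕ → ℕ → Prop) : Prop :=
  ∃ h : ℕ → ℕ, (∀ v < n, h v < K ∧ F v (h v)) ∧
    ∀ u < n, ∀ v < n, H u v → ¬R u → ¬R v → Compat q k i (h u) (h v)

/-- The tables after the remaining neighbors of `v` have been made consistent with `v`. -/
def pruned (H : ℕ → ℕ → Prop) (q k i K : ℕ) (R : ℕ → Prop) (F : ℕ → ℕ → Prop) (v u x : ℕ) : Prop :=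
  F u x ∧ (H v u ∧ ¬R u → ∃ y < K, F v y ∧ Compat q k i x y)

/-- At most one neighbor of `v` remains outside `R`. -/
def IsLeaf (H : ℕ → ℕ → Prop) (n : ℕ) (R : ℕ → Prop) (v : ℕ) : Prop :=
  ∀ u < n, ∀ u' < n, (H v u ∧ ¬R u) → (H v u' ∧ ¬R u') → u = u'

/-- The key step of the elimination. A solution of the pruned problem may violate the edges at `v`,
but only one edge there matters, and pruning has left at its other end a code with a partner in the
list of `v`; `v` is recolored by that partner. Conversely, a solution of the full problem survives,
since its value at `v` witnesses every pruning condition. -/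
theorem solvable_pruned {H : ℕ → ℕ → Prop} {n q k i K : ℕ} {R : ℕ → Prop} {F : ℕ → ℕ → Prop}
    {v : ℕ} (hs : ∀ u v, H u v → H v u) (hi : ∀ v, ¬H v v) (hv : v < n) (hR : ¬R v)
    (hl : IsLeaf H n R v) :
    Solvable H n q k i K (fun u => (u = v ∧ True) ∨ (u ≠ v ∧ R u)) (pruned H q k i K R F v) ↔
      Solvable H n q k i K R F := by
  constructor
  · rintro ⟨h, h1, h2⟩
    have hext : ∃ y < K, F v y ∧ ∀ u < n, H v u → ¬R u → Compat q k i (h u) y := by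
      by_cases hu : ∃ u < n, H v u ∧ ¬R u
      -- The one remaining neighbor `u`: the pruning condition for `h u` supplies the new code of
      -- `v`.
      · obtain ⟨u, hu, h3⟩ := hu
        obtain ⟨y, hy, h4, h5⟩ := (h1 u hu).2.2 h3
        refine ⟨y, hy, h4, fun u' hu' h6 h7 => ?_⟩
        rw [hl u' hu' u hu ⟨h6, h7⟩ h3]
        exact h5
      -- Without a remaining neighbor the old code of `v` can stay.
      · exact ⟨h v, (h1 v hv).1, (h1 v hv).2.1, fun u hu' h3 h4 => absurd ⟨u, hu', h3, h4⟩ hu⟩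
    obtain ⟨y, hy, h3, h4⟩ := hext
    refine ⟨fun u => if u = v then y else h u, ?_, ?_⟩
    · intro u hu
      by_cases huv : u = v
      · subst huv
        simpa using ⟨hy, h3⟩
      · simpa [huv] using ⟨(h1 u hu).1, (h1 u hu).2.1⟩
    · intro u hu u' hu' h5 h6 h7
      by_cases huv : u = v <;> by_cases huv' : u' = v
      · subst huv huv'
        exact absurd h5 (hi _)
      · subst huv
        simp only [if_true, huv', if_false]
        exact (h4 u' hu' h5 h7).symm
      · subst huv'
        simp only [if_true, huv, if_false]
        exact h4 u hu (hs _ _ h5) h6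
      · simp only [huv, huv', if_false]
        exact h2 u hu u' hu' h5 (by tauto) (by tauto)
  · rintro ⟨h, h1, h2⟩
    refine ⟨h, fun u hu => ⟨(h1 u hu).1, (h1 u hu).2, ?_⟩, ?_⟩
    · rintro ⟨h3, h4⟩
      exact ⟨h v, (h1 v hv).1, (h1 v hv).2, h2 u hu v hv (hs _ _ h3) h4 hR⟩
    · intro u hu u' hu' h3 h4 h5
      exact h2 u hu u' hu' h3 (by by_cases u = v <;> tauto) (by by_cases u' = v <;> tauto)

theorem Holds.congr {n K : ℕ} {m a : ℕ → ℕ} {R R' : ℕ → Prop} {F F' : ℕ → ℕ → Prop}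
    (h : Holds n K m a R F) (hR : ∀ v < n, R v ↔ R' v) (hF : ∀ v < n, ∀ x < K, F v x ↔ F' v x) :
    Holds n K m a R' F' :=
  ⟨h.code, fun v hv => (h.removed v hv).trans (ind_congr (hR v hv)),
    fun v hv x hx => (h.table v hv x hx).trans (ind_congr (hF v hv x hx))⟩

/-- The expression tested by `pruneP` for all codes `y`. -/
def pruneE (k i : ℕ) : WExpr :=
  (WExpr.op .mul (.load (tableA (.reg 5) (.reg 8))) (compatE k i (.reg 7) (.reg 8))).neg

/-- The value stored by `pruneP`. -/
def pruneV : WExpr := .op .mul (.load (tableA (.reg 6) (.reg 7))) (WExpr.reg 9).neg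

/-- The condition under which `pruneP` changes a row. -/
def nbrE (o : ℕ) : WExpr :=
  .op .mul (forestE o (.reg 5) (.reg 6)) (WExpr.load (removedA (.reg 6))).neg

/-- Make the remaining neighbors of the vertex in register `5` consistent with it. -/
def pruneP (o k i : ℕ) : WProg :=
  .forLoop 6 2 (.branch (nbrE o)
    (.forLoop 7 3 (.seq (allLoop 8 3 (pruneE k i)) (.store (tableA (.reg 6) (.reg 7)) pruneV)))
    .skip)

theorem prune_runs (o k i : ℕ) : ∃ c, ∀ {M n q K adj mem σ},
    Fit M o n q k i K adj mem → Base n q K σ → ∀ {a R F v}, Holds n K σ.mem a R F → v < n →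
    σ.regs 5 = v → ¬forestAdj adj mem v v →
    (pruneP o k i).Runs M σ (c * (K * K * n)) (fun τ =>
      Holds n K τ.mem a R (pruned (forestAdj adj mem) q k i K R F v)) := by
  obtain ⟨C, hC⟩ : ∃ C, C = 2 * (pruneE k i).cost + 40 +
    ((tableA (.reg 6) (.reg 7)).cost + pruneV.cost + 1) := ⟨_, rfl⟩
  refine ⟨2 * ((nbrE o).cost + 1 + ((2 * C + 20) + 1)) + 20, ?_⟩
  intro M n q K adj mem σ hM hB a R F v h0 hv hr5 hvv
  have hn := hM.n_pos
  have hK := hM.K_pos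
  have hnw := hM.n_lt
  have hKw := hM.K_lt
  have hKK : 1 ≤ K * K := Nat.mul_pos hK hK
  -- The table in mid-computation: the pruning condition has been imposed on the rows below `j` and
  -- on the first `l` entries of row `j`.
  let F' : ℕ → ℕ → ℕ → ℕ → Prop := fun j l u x => F u x ∧ ((u < j ∨ (u = j ∧ x < l)) →
    forestAdj adj mem v u ∧ ¬R u → ∃ y < K, F v y ∧ Compat q k i x y)
  refine (WProg.Runs.forLoop (fun j τ => Holds n K τ.mem a R (F' j 0)) hB.reg_n
    (by omega) (by simp [WProg.Keeps, WProg.keeps_forLoop, keeps_allLoop])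
    (by simp [WProg.Keeps, WProg.keeps_forLoop, keeps_allLoop]) (by simp) (A := K * K)
    hKK hn le_rfl ?_ ?_).mono le_rfl ?_
  · exact h0.congr (fun _ _ => Iff.rfl) fun u _ x _ =>
      ⟨fun h => ⟨h, fun h' => absurd h' (by omega)⟩, fun h => h.1⟩
  · intro u hu τ hI hr6 hk
    have hB1 : Base n q K τ := hB.congr
      (hk 1 (by simp [WProg.Keeps, WProg.keeps_forLoop, keeps_allLoop]) (by simp))
      (hk 2 (by simp [WProg.Keeps, WProg.keeps_forLoop, keeps_allLoop]) (by simp))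
      (hk 3 (by simp [WProg.Keeps, WProg.keeps_forLoop, keeps_allLoop]) (by simp))
    have hr5' : τ.regs 5 = v :=
      (hk 5 (by simp [WProg.Keeps, WProg.keeps_forLoop, keeps_allLoop]) (by simp)).trans hr5
    have h5 : (WExpr.reg 5).HasVal M τ v := .reg hr5' (by omega)
    have h6 : (WExpr.reg 6).HasVal M τ u := .reg hr6 (by omega)
    refine (WProg.Runs.branch (T := (2 * C + 20) * (K * K)) (T' := 1)
      (WExpr.HasVal.mul_ind (hM.val_forest hB1 h5 h6 hv hu)
        ((hM.val_removed hB1 hI h6 hu).neg hM.one_lt) hM.one_lt) ?_ ?_).mono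
      (add_le_add_mul (le_mul_of_one_le _ hKK) (add_le_add_mul le_rfl (by omega))) fun _ h => h
    · rintro ⟨hH, hR⟩
      have huv : v ≠ u := by rintro rfl; exact hvv hH
      refine (WProg.Runs.forLoop (fun l τ => Holds n K τ.mem a R (F' u l)) hB1.reg_K
        (by omega) (by simp [WProg.Keeps, keeps_allLoop])
        (by simp [WProg.Keeps, keeps_allLoop]) (by simp) hK hK le_rfl hI ?_).mono le_rfl ?_
      · intro x hx ρ hJ hr7 hk2
        have hB2 : Base n q K ρ := hB1.congr (hk2 1 (by simp [WProg.Keeps, keeps_allLoop])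
          (by simp)) (hk2 2 (by simp [WProg.Keeps, keeps_allLoop]) (by simp))
          (hk2 3 (by simp [WProg.Keeps, keeps_allLoop]) (by simp))
        have hr5'' : ρ.regs 5 = v :=
          (hk2 5 (by simp [WProg.Keeps, keeps_allLoop]) (by simp)).trans hr5'
        have hr6' : ρ.regs 6 = u :=
          (hk2 6 (by simp [WProg.Keeps, keeps_allLoop]) (by simp)).trans hr6
        refine (WProg.Runs.seq (allLoop_runs (N := K) (B := K) (p := fun y =>
          ¬(F' u x v y ∧ Compat q k i x y)) (by omega) hB2.reg_K (by simp)
          (by simp) (by simp) hK le_rfl ?_ hM.one_lt)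
          (T' := (tableA (.reg 6) (.reg 7)).cost + pruneV.cost + 1)
          ?_).mono ?_ fun _ h => h
        · intro y hy ρ' hmem hr8 hk3
          have hB3 : Base n q K ρ' := hB2.congr (hk3 1 (by simp) (by simp))
            (hk3 2 (by simp) (by simp)) (hk3 3 (by simp) (by simp))
          have h5 : (WExpr.reg 5).HasVal M ρ' v :=
            .reg ((hk3 5 (by simp) (by simp)).trans hr5'') (by omega)
          have h7 : (WExpr.reg 7).HasVal M ρ' x :=
            .reg ((hk3 7 (by simp) (by simp)).trans hr7) (by omega)
          have h8 : (WExpr.reg 8).HasVal M ρ' y := .reg hr8 (by omega)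
          exact WExpr.HasVal.neg (.mul_ind (hM.val_table hB3 (hmem ▸ hJ) h5 h8 hv hy)
            (hM.val_compat hB3 h7 h8) hM.one_lt) hM.one_lt
        · rintro ρ' ⟨h9, hmem, hk3⟩
          have hB3 : Base n q K ρ' := hB2.congr (hk3 1 (by simp) (by simp))
            (hk3 2 (by simp) (by simp)) (hk3 3 (by simp) (by simp))
          have h6 : (WExpr.reg 6).HasVal M ρ' u :=
            .reg ((hk3 6 (by simp) (by simp)).trans hr6') (by omega)
          have h7 : (WExpr.reg 7).HasVal M ρ' x :=
            .reg ((hk3 7 (by simp) (by simp)).trans hr7) (by omega)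
          have hJ' : Holds n K ρ'.mem a R (F' u x) := hmem ▸ hJ
          refine hM.store_table hB3 h6 h7 hu hx (.mul_ind (hM.val_table hB3 hJ' h6 h7 hu hx)
            (WExpr.HasVal.neg (hM.val_ind h9) hM.one_lt) hM.one_lt) ?_
          rw [WState.setReg_mem]
          refine (hJ'.setTable hx _).congr (fun _ _ => Iff.rfl) fun u' _ x' _ => ?_
          -- Pruning in place is sound because `v` is not its own neighbor: the row of `v` being
          -- read still holds its original entries.
          have hFv : ∀ y, F' u x v y ↔ F v y := fun y =>
            ⟨fun h => h.1, fun h => ⟨h, fun _ h' => absurd h'.1 hvv⟩⟩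
          simp only [hFv]
          have hex : (¬∀ y < K, ¬(F v y ∧ Compat q k i x y)) ↔
              ∃ y < K, F v y ∧ Compat q k i x y := by push Not; rfl
          rw [hex]
          by_cases hux : u' = u ∧ x' = x
          · obtain ⟨rfl, rfl⟩ := hux
            constructor
            · rintro (⟨-, -, h1, h2⟩ | h1)
              · exact ⟨h1.1, fun _ _ => h2⟩
              · exact absurd ⟨rfl, rfl⟩ h1.1
            · rintro ⟨h1, h2⟩
              exact Or.inl ⟨rfl, rfl, ⟨h1, fun h => absurd h (by omega)⟩,
                h2 (by omega) ⟨hH, hR⟩⟩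
          · simp only [F']
            have : (u' < u ∨ u' = u ∧ x' < x) ↔ (u' < u ∨ u' = u ∧ x' < x + 1) := by omega
            rw [this]
            tauto
        · rw [hC]
          exact add_le_add_mul le_rfl (le_mul_of_one_le _ hK)
      · rintro τ' ⟨h1, -⟩
        refine h1.congr (fun _ _ => Iff.rfl) fun u' _ x' hx' => ?_
        have : (u' < u ∨ u' = u ∧ x' < K) ↔ (u' < u + 1 ∨ u' = u + 1 ∧ x' < 0) := by omega
        simp only [F', this]
    · intro hc
      refine .skip ?_
      refine hI.congr (fun _ _ => Iff.rfl) fun u' _ x' _ => ?_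
      simp only [F']
      -- For a vertex that is not a remaining neighbor of `v` the pruning condition is vacuous, so
      -- the row may be skipped.
      refine and_congr Iff.rfl ⟨fun h h1 h2 => ?_, fun h h1 h2 => h (by omega) h2⟩
      by_cases huu : u' = u
      · subst huu
        exact absurd h2 hc
      · exact h (by omega) h2
  · rintro τ ⟨h1, -⟩
    refine h1.congr (fun _ _ => Iff.rfl) fun u hu x _ => ?_
    exact and_congr Iff.rfl ⟨fun h => h (Or.inl hu), fun h _ => h⟩

/-- The condition under which `elimP` eliminates the vertex in register `5`. -/
def leafE : WExpr := .op .mul (WExpr.load (removedA (.reg 5))).neg (.op .lt (.reg 9) (.lit 2))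

/-- Eliminate the vertex in register `5` if at most one neighbor remains. -/
def elimP (o k i : ℕ) : WProg :=
  .seq (sumLoop 6 2 (nbrE o)) (.branch leafE
    (.seq (pruneP o k i) (.store (removedA (.reg 5)) (.lit 1))) .skip)

theorem elim_runs (o k i : ℕ) : ∃ c, ∀ {M n q K adj mem σ},
    Fit M o n q k i K adj mem → Base n q K σ → ∀ {a R F v}, Holds n K σ.mem a R F → v < n →
    σ.regs 5 = v → ¬forestAdj adj mem v v →
    (elimP o k i).Runs M σ (c * (K * K * n)) (fun τ =>
      ((¬R v ∧ IsLeaf (forestAdj adj mem) n R v) → Holds n K τ.mem a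
        (fun u => (u = v ∧ True) ∨ (u ≠ v ∧ R u)) (pruned (forestAdj adj mem) q k i K R F v)) ∧
      (¬(¬R v ∧ IsLeaf (forestAdj adj mem) n R v) → Holds n K τ.mem a R F)) := by
  obtain ⟨C, hC⟩ := prune_runs o k i
  refine ⟨(2 * (nbrE o).cost + 40) + (leafE.cost + 1 + ((C + 5) + 1)), ?_⟩
  intro M n q K adj mem σ hM hB a R F v h0 hv hr5 hvv
  have hn := hM.n_pos
  have hK := hM.K_pos
  have hnw := hM.n_lt
  have hKK : 1 ≤ K * K := Nat.mul_pos hK hK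
  have hA : 1 ≤ K * K * n := Nat.mul_pos hKK hn
  refine (WProg.Runs.seq (T' := (leafE.cost + 1 + ((C + 5) + 1)) * (K * K * n))
    (sumLoop_runs (N := n) (B := n)
    (p := fun u => forestAdj adj mem v u ∧ ¬R u) (by omega) hB.reg_n (by simp) (by simp) (by simp)
    hn le_rfl ?_) ?_).mono ?_ fun _ h => h
  · intro u hu τ hmem hr6 hk
    have hB1 : Base n q K τ := hB.congr (hk 1 (by simp) (by simp))
      (hk 2 (by simp) (by simp)) (hk 3 (by simp) (by simp))
    have h5 : (WExpr.reg 5).HasVal M τ v :=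
      .reg ((hk 5 (by simp) (by simp)).trans hr5) (by omega)
    have h6 : (WExpr.reg 6).HasVal M τ u := .reg hr6 (by omega)
    have hI : Holds n K τ.mem a R F := hmem ▸ h0
    exact WExpr.HasVal.mul_ind (hM.val_forest hB1 h5 h6 hv hu)
      ((hM.val_removed hB1 hI h6 hu).neg hM.one_lt) hM.one_lt
  · rintro τ ⟨h9, hmem, hk⟩
    have hB1 : Base n q K τ := hB.congr (hk 1 (by simp) (by simp))
      (hk 2 (by simp) (by simp)) (hk 3 (by simp) (by simp))
    have hr5' : τ.regs 5 = v := (hk 5 (by simp) (by simp)).trans hr5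
    have h5 : (WExpr.reg 5).HasVal M τ v := .reg hr5' (by omega)
    have hI : Holds n K τ.mem a R F := hmem ▸ h0
    have hsum := sum_ind_le (fun u => forestAdj adj mem v u ∧ ¬R u) n
    have htwo := hM.two_lt
    refine (WProg.Runs.branch (c := ¬R v ∧ IsLeaf (forestAdj adj mem) n R v)
      (T := (C + 5) * (K * K * n)) (T' := 1) ?_ ?_ ?_).mono
      (add_le_add_mul (le_mul_of_one_le _ hA) (add_le_add_mul le_rfl (by omega))) fun _ h => h
    · refine (WExpr.HasVal.mul_ind ((hM.val_removed hB1 hI h5 hv).neg hM.one_lt)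
        (.lt_ind (.reg h9 (by omega)) (.lit htwo) hM.one_lt) hM.one_lt).congr (ind_congr ?_)
      rw [sum_ind_lt_two]
      rfl
    · intro hc
      refine (WProg.Runs.seq (T' := 5) (hC hM hB1 hI hv hr5' hvv).frame ?_).mono
        (add_le_add_mul le_rfl (le_mul_of_one_le _ hA)) fun _ h => h
      rintro τ' ⟨h1, hk2⟩
      have hB2 : Base n q K τ' := hB1.congr
        (hk2 1 (by simp [pruneP, WProg.Keeps, WProg.keeps_forLoop, keeps_allLoop]))
        (hk2 2 (by simp [pruneP, WProg.Keeps, WProg.keeps_forLoop, keeps_allLoop]))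
        (hk2 3 (by simp [pruneP, WProg.Keeps, WProg.keeps_forLoop, keeps_allLoop]))
      have h5' : (WExpr.reg 5).HasVal M τ' v :=
        .reg ((hk2 5 (by simp [pruneP, WProg.Keeps, WProg.keeps_forLoop, keeps_allLoop])).trans
          hr5') (by omega)
      refine hM.store_removed (p := True) hB2 h5' hv
        ((WExpr.HasVal.lit hM.one_lt).congr (ind_true trivial).symm) ?_
      exact ⟨fun _ => h1.setRemoved hv True, fun h => absurd hc h⟩
    · intro hc
      exact .skip ⟨fun h => absurd h hc, fun _ => hI⟩
  · exact add_le_add_mul (Nat.mul_le_mul_left _ (Nat.le_mul_of_pos_left _ hKK)) le_rfl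

/-- Eliminate all vertices. -/
def sweepsP (o k i : ℕ) : WProg := .forLoop 10 2 (.forLoop 5 2 (elimP o k i))

/-- While some vertex remains, the forest has one with at most one remaining neighbor, and a sweep
over all vertices meets it. So every sweep eliminates at least one vertex until none is left, and
`n` sweeps suffice in whatever order the vertices come. -/
theorem sweeps_runs (o k i : ℕ) : ∃ c, ∀ {M n q K adj mem σ},
    Fit M o n q k i K adj mem → Base n q K σ → (∀ u v, adj u v → adj v u) → (∀ v, ¬adj v v) →
    IsForest n (forestAdj adj mem) → ∀ {a R F}, Holds n K σ.mem a R F →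
    (sweepsP o k i).Runs M σ (c * (K * K * n * n * n)) (fun τ =>
      ∃ R' F', Holds n K τ.mem a R' F' ∧ (∀ v < n, R' v) ∧
        (Solvable (forestAdj adj mem) n q k i K R' F' ↔
          Solvable (forestAdj adj mem) n q k i K R F)) := by
  obtain ⟨C, hC⟩ := elim_runs o k i
  refine ⟨2 * (2 * C + 20) + 20, ?_⟩
  intro M n q K adj mem σ hM hB hs hi hF a R₀ F₀ h0
  have hn := hM.n_pos
  have hK := hM.K_pos
  have hnw := hM.n_lt
  have hA : 1 ≤ K * K * n := Nat.mul_pos (Nat.mul_pos hK hK) hn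
  have hA' : 1 ≤ K * K * n * n := Nat.mul_pos hA hn
  set H := forestAdj adj mem with hH
  have hs' : ∀ u v, H u v → H v u := fun u v h => ⟨hs _ _ h.1, h.2.2, h.2.1⟩
  have hi' : ∀ v, ¬H v v := fun v h => hi v h.1
  have hkeep : ∀ z ≠ 5, z ≠ 6 → z ≠ 7 → z ≠ 8 → z ≠ 9 → (elimP o k i).Keeps z := by
    intro z h5 h6 h7 h8 h9
    simp [elimP, pruneP, WProg.Keeps, WProg.keeps_forLoop, keeps_allLoop, keeps_sumLoop, *]
  have hkeep5 : (elimP o k i).Keeps 5 := by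
    simp [elimP, pruneP, WProg.Keeps, WProg.keeps_forLoop, keeps_allLoop, keeps_sumLoop]
  -- After `j` sweeps at least `j` vertices have been eliminated, and solvability is unchanged.
  refine (WProg.Runs.forLoop (fun j τ => ∃ R F, Holds n K τ.mem a R F ∧
    (Solvable H n q k i K R F ↔ Solvable H n q k i K R₀ F₀) ∧
    j ≤ ∑ v ∈ Finset.range n, ind (R v)) hB.reg_n
    (by omega) (by simp [WProg.keeps_forLoop, hkeep])
    (by simp [WProg.keeps_forLoop, hkeep]) (by simp) hA' hn le_rfl ?_ ?_).mono le_rfl ?_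
  · exact ⟨R₀, F₀, h0, Iff.rfl, Nat.zero_le _⟩
  · rintro j hj τ ⟨R₁, F₁, h1, h2, h3⟩ - hk
    have hB1 : Base n q K τ := hB.congr
      (hk 1 (by simp [WProg.keeps_forLoop, hkeep]) (by simp))
      (hk 2 (by simp [WProg.keeps_forLoop, hkeep]) (by simp))
      (hk 3 (by simp [WProg.keeps_forLoop, hkeep]) (by simp))
    -- Within a sweep, progress is measured against the set `R₁` at its beginning: every vertex
    -- below `l` that was a leaf then is gone by now.
    refine (WProg.Runs.forLoop (fun l τ => ∃ R F, Holds n K τ.mem a R F ∧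
      (Solvable H n q k i K R F ↔ Solvable H n q k i K R₀ F₀) ∧
      (∀ v, R₁ v → R v) ∧ ∀ v < l, ¬R₁ v → IsLeaf H n R₁ v → R v) hB1.reg_n
      (by omega) hkeep5 (hkeep 2 (by simp) (by simp) (by simp) (by simp) (by simp)) (by simp) hA
      hn le_rfl ?_ ?_).mono le_rfl ?_
    · exact ⟨R₁, F₁, h1, h2, fun _ h => h, fun v hv => absurd hv (by omega)⟩
    · rintro v hv ρ ⟨R, F, h4, h5, h6, h7⟩ hr5 hk2
      have hB2 : Base n q K ρ := hB1.congr
        (hk2 1 (hkeep 1 (by simp) (by simp) (by simp) (by simp) (by simp)) (by simp))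
        (hk2 2 (hkeep 2 (by simp) (by simp) (by simp) (by simp) (by simp)) (by simp))
        (hk2 3 (hkeep 3 (by simp) (by simp) (by simp) (by simp) (by simp)) (by simp))
      refine (hC hM hB2 h4 hv hr5 (hi' v)).mono le_rfl ?_
      rintro ρ' ⟨h8, h9⟩
      rw [WState.setReg_mem]
      by_cases hc : ¬R v ∧ IsLeaf H n R v
      · refine ⟨_, _, h8 hc, (solvable_pruned hs' hi' hv hc.1 hc.2).trans h5, ?_, ?_⟩
        · intro u hu
          by_cases huv : u = v
          · exact Or.inl ⟨huv, trivial⟩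
          · exact Or.inr ⟨huv, h6 u hu⟩
        · intro u hu h10 h11
          by_cases huv : u = v
          · exact Or.inl ⟨huv, trivial⟩
          · exact Or.inr ⟨huv, h7 u (by omega) h10 h11⟩
      · refine ⟨_, _, h9 hc, h5, h6, ?_⟩
        intro u hu h10 h11
        by_cases huv : u = v
        · subst huv
          by_contra h12
          -- A leaf stays a leaf when more vertices are eliminated.
          exact hc ⟨h12, fun w hw w' hw' h13 h14 => h11 w hw w' hw'
            ⟨h13.1, fun h => h13.2 (h6 _ h)⟩ ⟨h14.1, fun h => h14.2 (h6 _ h)⟩⟩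
        · exact h7 u (by omega) h10 h11
    · rintro ρ ⟨⟨R, F, h4, h5, h6, h7⟩, -⟩
      refine ⟨R, F, h4, h5, ?_⟩
      have hmono : ∀ v ∈ Finset.range n, ind (R₁ v) ≤ ind (R v) := by
        intro v _
        by_cases h : R₁ v
        · rw [ind_true h, ind_true (h6 v h)]
        · rw [ind_false h]
          exact Nat.zero_le _
      by_cases hall : ∃ v < n, ¬R₁ v
      · obtain ⟨v, hv, h8, h9⟩ := hF R₁ hall
        have : ∑ v ∈ Finset.range n, ind (R₁ v) < ∑ v ∈ Finset.range n, ind (R v) := by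
          refine Finset.sum_lt_sum hmono ⟨v, Finset.mem_range.2 hv, ?_⟩
          rw [ind_false h8, ind_true (h7 v hv h8 fun u hu u' hu' h10 h11 =>
            h9 u hu u' hu' h10.1 h10.2 h11.1 h11.2)]
          exact Nat.one_pos
        omega
      · push Not at hall
        -- If nothing was left at the beginning of the sweep, the count is already `n`, which is at
        -- least `j + 1`.
        have : ∑ v ∈ Finset.range n, ind (R v) = n := by
          rw [Finset.sum_congr rfl fun v hv => ind_true (h6 v (hall v (Finset.mem_range.1 hv)))]
          simp
        omega
  · rintro τ ⟨⟨R, F, h1, h2, h3⟩, -⟩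
    refine ⟨R, F, h1, ?_, h2⟩
    intro v hv
    by_contra h
    have : ∑ v ∈ Finset.range n, ind (R v) < ∑ v ∈ Finset.range n, 1 :=
      Finset.sum_lt_sum (fun v _ => ind_le_one _) ⟨v, Finset.mem_range.2 hv, by
        rw [ind_false h]; exact Nat.one_pos⟩
    simp only [Finset.sum_const, Finset.card_range, smul_eq_mul, mul_one] at this
    omega

/-- Register `11` becomes the truth value of no table row being empty. -/
def checkP : WProg :=
  .seq (.assign 11 (.lit 1)) (.forLoop 5 2
    (.seq (allLoop 7 3 (WExpr.load (tableA (.reg 5) (.reg 7))).neg)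
      (.assign 11 (.op .mul (.reg 11) (WExpr.reg 9).neg))))

theorem check_runs : ∃ c, ∀ {M o k i n q K adj mem σ},
    Fit M o n q k i K adj mem → Base n q K σ → ∀ {a R F}, Holds n K σ.mem a R F →
    checkP.Runs M σ (c * (K * n)) (fun τ => τ.mem = σ.mem ∧
      τ.regs 11 = ind (∀ v < n, ∃ x < K, F v x)) := by
  obtain ⟨C, hC⟩ : ∃ C, C = 2 * (WExpr.load (tableA (.reg 5) (.reg 7))).neg.cost + 40 + 6 :=
    ⟨_, rfl⟩
  refine ⟨2 + (2 * C + 20), ?_⟩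
  intro M o k i n q K adj mem σ hM hB a R F h0
  have hn := hM.n_pos
  have hK := hM.K_pos
  have hnw := hM.n_lt
  have hKw := hM.K_lt
  refine (WProg.Runs.seq (T' := (2 * C + 20) * (K * n)) (Q₁ := fun τ => τ = σ.setReg 11 1)
    (.assign (.lit hM.one_lt) rfl) ?_).mono
    (add_le_add_mul (le_mul_of_one_le _ (Nat.mul_pos hK hn)) le_rfl) fun _ h => h
  rintro _ rfl
  refine (WProg.Runs.forLoop (fun j τ => τ.mem = σ.mem ∧ τ.regs 11 = ind (∀ v < j, ∃ x < K, F v x))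
    (y := 2) (N := n) (by simp [hB.reg_n]) (by omega) (by simp [WProg.Keeps, keeps_allLoop])
    (by simp [WProg.Keeps, keeps_allLoop]) (by simp) hK hn le_rfl ?_ ?_).mono le_rfl fun _ h => h.1
  · simp [ind_true]
  · rintro v hv τ ⟨h1, h2⟩ hr5 hk
    have hB1 : Base n q K τ := hB.congr
      ((hk 1 (by simp [WProg.Keeps, keeps_allLoop]) (by simp)).trans (by simp))
      ((hk 2 (by simp [WProg.Keeps, keeps_allLoop]) (by simp)).trans (by simp))
      ((hk 3 (by simp [WProg.Keeps, keeps_allLoop]) (by simp)).trans (by simp))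
    refine (WProg.Runs.seq (T' := 6) (allLoop_runs (N := K) (B := K) (p := fun x => ¬F v x)
      (by omega) hB1.reg_K (by simp) (by simp) (by simp) hK le_rfl ?_ hM.one_lt) ?_).mono ?_
      fun _ h => h
    · intro x hx ρ hmem hr7 hk2
      have hB2 : Base n q K ρ := hB1.congr (hk2 1 (by simp) (by simp))
        (hk2 2 (by simp) (by simp)) (hk2 3 (by simp) (by simp))
      have h5 : (WExpr.reg 5).HasVal M ρ v :=
        .reg ((hk2 5 (by simp) (by simp)).trans hr5) (by omega)
      have h7 : (WExpr.reg 7).HasVal M ρ x := .reg hr7 (by omega)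
      have hI : Holds n K ρ.mem a R F := by rw [hmem, h1]; exact h0
      exact (hM.val_table hB2 hI h5 h7 hv hx).neg hM.one_lt
    · rintro ρ ⟨h9, hmem, hk2⟩
      have h11 : ρ.regs 11 = ind (∀ v' < v, ∃ x < K, F v' x) :=
        (hk2 11 (by simp) (by simp)).trans h2
      refine .assign (.mul_ind (hM.val_ind h11) (WExpr.HasVal.neg (hM.val_ind h9) hM.one_lt)
        hM.one_lt) ?_
      simp only [WState.setReg_mem, WState.setReg_regs]
      refine ⟨hmem.trans h1, ?_⟩
      simp only [if_true]
      rw [if_neg (by simp)]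
      refine ind_congr ?_
      rw [Nat.forall_lt_succ_right]
      push Not
      rfl
    · rw [hC]
      exact add_le_add_mul le_rfl (le_mul_of_one_le _ hK)

/-- Some proper coloring extends the coloring `a` of the feedback vertex set. -/
def Extends (adj : ℕ → ℕ → Prop) (mem : ℕ → Prop) (n q k i : ℕ) (a : ℕ → ℕ) : Prop :=
  ∃ h, IsCodeColoring adj n q k i h ∧ ∀ v < n, mem v → h v = a v

/-- The lists encode all edges that meet `S`, and the list of a vertex of `S` contains at most its
prescribed code. It is empty if that code conflicts with a neighbor in `S`, so `a` itself need not
be proper. -/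
theorem solvable_initTable {adj : ℕ → ℕ → Prop} {mem : ℕ → Prop} {n q k i : ℕ} {a : ℕ → ℕ}
    (hs : ∀ u v, adj u v → adj v u) :
    Solvable (forestAdj adj mem) n q k i (q ^ k) (fun _ => False)
      (initTable adj mem n q k i a) ↔ Extends adj mem n q k i a := by
  constructor
  · rintro ⟨h, h1, h2⟩
    have h3 : ∀ v < n, mem v → h v = a v := fun v hv hm => by
      by_contra h4
      exact (h1 v hv).2.2.2 ⟨hm, h4⟩
    have h4 : ∀ u < n, ∀ v < n, mem u → adj u v → Compat q k i (h u) (h v) := by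
      intro u hu v hv hm huv
      rw [h3 u hu hm]
      by_contra h5
      exact (h1 v hv).2.1 u hu ⟨⟨hm, huv⟩, h5⟩
    refine ⟨h, ⟨fun v hv => ⟨(h1 v hv).1, (h1 v hv).2.2.1⟩, ?_⟩, h3⟩
    intro u hu v hv huv
    by_cases hmu : mem u
    · exact h4 u hu v hv hmu huv
    · by_cases hmv : mem v
      · exact (h4 v hv u hu hmv (hs _ _ huv)).symm
      · exact h2 u hu v hv ⟨huv, hmu, hmv⟩ not_false not_false
  · rintro ⟨h, ⟨h1, h2⟩, h3⟩
    refine ⟨h, fun v hv => ⟨(h1 v hv).1, ?_, (h1 v hv).2, ?_⟩,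
      fun u hu v hv huv _ _ => h2 u hu v hv huv.1⟩
    · rintro u hu ⟨⟨h4, h5⟩, h6⟩
      rw [← h3 u hu h4] at h6
      exact h6 (h2 u hu v hv h5)
    · rintro ⟨h4, h5⟩
      exact h5 (h3 v hv h4)

/-- With all vertices eliminated no edge constraint is left, and codes can be chosen independently.
-/
theorem solvable_of_removed {H : ℕ → ℕ → Prop} {n q k i K : ℕ} {R : ℕ → Prop}
    {F : ℕ → ℕ → Prop} (hR : ∀ v < n, R v) :
    Solvable H n q k i K R F ↔ ∀ v < n, ∃ x < K, F v x := by
  constructor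
  · rintro ⟨h, h1, -⟩ v hv
    exact ⟨h v, h1 v hv⟩
  · intro h
    choose! f hf using h
    exact ⟨f, hf, fun u hu v _ _ h1 => absurd (hR u hu) h1⟩

/-- Put the disjunction of register `0` and the truth value of the stored coloring having an
extension into register `0`. -/
def testP (o k i : ℕ) : WProg :=
  .seq (fillP o k i) (.seq (sweepsP o k i) (.seq checkP
    (.assign 0 (WExpr.op .mul (WExpr.reg 0).neg (WExpr.reg 11).neg).neg)))

theorem keeps_testP {o k i z : ℕ} (hz : z < 5 ∨ 11 < z) (h0 : z ≠ 0) : (testP o k i).Keeps z := by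
  simp only [testP, fillP, sweepsP, elimP, pruneP, checkP, WProg.Keeps, WProg.keeps_forLoop,
    keeps_allLoop, keeps_sumLoop, true_and, and_true]
  omega

theorem test_runs (o k i : ℕ) : ∃ c, ∀ {M n q K adj mem σ},
    Fit M o n q k i K adj mem → Base n q K σ → (∀ u v, adj u v → adj v u) → (∀ v, ¬adj v v) →
    IsForest n (forestAdj adj mem) → ∀ {a : ℕ → ℕ} {p : Prop}, (∀ v < n, σ.mem v = a v) →
    (∀ v < n, a v < K) → σ.regs 0 = ind p →
    (testP o k i).Runs M σ (c * (K * K * n * n * n)) (fun τ => (∀ v < n, τ.mem v = a v) ∧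
      τ.regs 0 = ind (p ∨ Extends adj mem n q k i a)) := by
  obtain ⟨c₁, h₁⟩ := fill_runs o k i
  obtain ⟨c₂, h₂⟩ := sweeps_runs o k i
  obtain ⟨c₃, h₃⟩ := check_runs
  refine ⟨c₁ + (c₂ + (c₃ + 10)), ?_⟩
  intro M n q K adj mem σ hM hB hs hi hF a p ha haK h0
  have hn := hM.n_pos
  have hK := hM.K_pos
  -- The sweeps dominate; filling the tables and the final check are absorbed into the same
  -- monomial.
  have e1 : n * K * n ≤ K * K * n * n * n := by
    have : 1 ≤ K * n := Nat.mul_pos hK hn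
    calc n * K * n = (n * K * n) * 1 := (mul_one _).symm
      _ ≤ (n * K * n) * (K * n) := Nat.mul_le_mul_left _ this
      _ = _ := by ring
  have e2 : K * n ≤ K * K * n * n * n := by
    have : 1 ≤ K * n * n := Nat.mul_pos (Nat.mul_pos hK hn) hn
    calc K * n = (K * n) * 1 := (mul_one _).symm
      _ ≤ (K * n) * (K * n * n) := Nat.mul_le_mul_left _ this
      _ = _ := by ring
  refine (WProg.Runs.seq (T' := (c₂ + (c₃ + 10)) * (K * K * n * n * n))
    (h₁ hM hB a ha haK).frame ?_).mono
    (add_le_add_mul (Nat.mul_le_mul_left _ e1) le_rfl) fun _ h => h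
  rintro τ₁ ⟨g1, k1⟩
  have kf : ∀ z, (z < 5 ∨ 9 < z) → (fillP o k i).Keeps z := by
    intro z hz
    simp only [fillP, WProg.Keeps, WProg.keeps_forLoop, keeps_allLoop, true_and, and_true]
    omega
  have hB1 : Base n q K τ₁ := hB.congr (k1 1 (kf 1 (by simp))) (k1 2 (kf 2 (by simp)))
    (k1 3 (kf 3 (by simp)))
  refine (WProg.Runs.seq (T' := (c₃ + 10) * (K * K * n * n * n))
    (h₂ hM hB1 hs hi hF g1).frame ?_).mono
    (add_le_add_mul le_rfl le_rfl) fun _ h => h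
  rintro τ₂ ⟨⟨R, F, g2, g3, g4⟩, k2⟩
  have ks : ∀ z, (z < 5 ∨ 10 < z) → (sweepsP o k i).Keeps z := by
    intro z hz
    simp only [sweepsP, elimP, pruneP, WProg.Keeps, WProg.keeps_forLoop, keeps_allLoop,
      keeps_sumLoop, and_true]
    omega
  have hB2 : Base n q K τ₂ := hB1.congr (k2 1 (ks 1 (by simp))) (k2 2 (ks 2 (by simp)))
    (k2 3 (ks 3 (by simp)))
  refine (WProg.Runs.seq (T' := 10) (h₃ hM hB2 g2).frame ?_).mono
    (add_le_add_mul (Nat.mul_le_mul_left _ e2)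
      (le_mul_of_one_le _ ((Nat.mul_pos hK hn).trans_le e2))) fun _ h => h
  rintro τ₃ ⟨⟨g5, g6⟩, k3⟩
  have kc : checkP.Keeps 0 := by
    simp [checkP, WProg.Keeps, WProg.keeps_forLoop, keeps_allLoop]
  have h0' : τ₃.regs 0 = ind p := by
    rw [k3 0 kc, k2 0 (ks 0 (by simp)), k1 0 (kf 0 (by simp)), h0]
  refine (WProg.Runs.assign (WExpr.HasVal.neg (.mul_ind (WExpr.HasVal.neg (hM.val_ind h0')
    hM.one_lt) (WExpr.HasVal.neg (hM.val_ind g6) hM.one_lt) hM.one_lt) hM.one_lt) ?_).mono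
    (by simp [WExpr.cost, WExpr.neg]) fun _ h => h
  refine ⟨fun v hv => ?_, ?_⟩
  · rw [WState.setReg_mem, g5, g2.code v hv]
  · simp only [WState.setReg_regs, if_true]
    refine ind_congr ?_
    rw [← solvable_of_removed (H := forestAdj adj mem) (q := q) (k := k) (i := i) g3, g4,
      ← hM.pow_eq, solvable_initTable hs]
    tauto

/-! ### Enumeration of the colorings of the feedback vertex set -/

/-- The number of codes below `x`. -/
noncomputable def rank (q k x : ℕ) : ℕ := ∑ y ∈ Finset.range x, ind (IsCode q k y)

/-- The number of `u < v` that satisfy `mem`. -/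
noncomputable def countBelow (mem : ℕ → Prop) (v : ℕ) : ℕ := ∑ u ∈ Finset.range v, ind (mem u)

/-- The number whose mixed radix digits are the ranks of the codes `a u` for the vertices `u < v`
that satisfy `mem`. -/
noncomputable def position (mem : ℕ → Prop) (q k : ℕ) (a : ℕ → ℕ) (v : ℕ) : ℕ :=
  ∑ u ∈ Finset.range v, ind (mem u) * (rank q k (a u) * q.choose k ^ countBelow mem u)

/-! ### Ranks of codes and mixed radix positions of colorings -/

section Rank

variable {q k : ℕ}

theorem rank_succ_of_isCode {x : ℕ} (h : IsCode q k x) : rank q k (x + 1) = rank q k x + 1 := by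
  rw [rank, Finset.sum_range_succ, ind_true h, rank]

theorem rank_mono : Monotone (rank q k) := fun _ _ h =>
  Finset.sum_le_sum_of_subset (Finset.range_mono h)

theorem rank_eq_of_forall_not_isCode {x y : ℕ} (hxy : x ≤ y)
    (h : ∀ z, x ≤ z → z < y → ¬IsCode q k z) : rank q k y = rank q k x := by
  induction y, hxy using Nat.le_induction with
  | base => rfl
  | succ y hy ih =>
    rw [rank, Finset.sum_range_succ, ind_false (h y hy (by omega)), add_zero, ← rank,
      ih fun z hz hzy => h z hz (by omega)]

theorem rank_lt_rank {x y : ℕ} (hx : IsCode q k x) (h : x < y) : rank q k x < rank q k y := by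
  have := rank_mono (q := q) (k := k) (Nat.succ_le_of_lt h)
  rw [Nat.succ_eq_add_one, rank_succ_of_isCode hx] at this
  omega

theorem rank_injective {x y : ℕ} (hx : IsCode q k x) (hy : IsCode q k y)
    (h : rank q k x = rank q k y) : x = y := by
  rcases lt_trichotomy x y with h' | h' | h'
  · exact absurd (rank_lt_rank hx h') (by omega)
  · exact h'
  · exact absurd (rank_lt_rank hy h') (by omega)

theorem rank_pow (hq : 0 < q) : rank q k (q ^ k) = q.choose k := by
  classical
  rw [← card_isCode hq, Finset.card_filter, rank]
  exact Finset.sum_congr rfl fun j _ => (ite_eq_ind _).symm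

theorem rank_lt_choose (hq : 0 < q) {x : ℕ} (hx : IsCode q k x) (h : x < q ^ k) :
    rank q k x < q.choose k := rank_pow hq ▸ rank_lt_rank hx h

/-- `a` assigns codes to the vertices `v < n`. -/
def Codes (n q k : ℕ) (a : ℕ → ℕ) : Prop := ∀ v < n, a v < q ^ k ∧ IsCode q k (a v)

variable {mem : ℕ → Prop} {n : ℕ} {a b : ℕ → ℕ}

theorem countBelow_succ (mem : ℕ → Prop) (v : ℕ) :
    countBelow mem (v + 1) = countBelow mem v + ind (mem v) := Finset.sum_range_succ _ _

theorem position_succ (mem : ℕ → Prop) (q k : ℕ) (a : ℕ → ℕ) (v : ℕ) :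
    position mem q k a (v + 1) = position mem q k a v +
      ind (mem v) * (rank q k (a v) * q.choose k ^ countBelow mem v) := Finset.sum_range_succ _ _

theorem position_congr {v : ℕ} (h : ∀ u < v, a u = b u) :
    position mem q k a v = position mem q k b v :=
  Finset.sum_congr rfl fun u hu => by rw [h u (Finset.mem_range.1 hu)]

/-- Each vertex of `S` contributes one digit in base `q.choose k`, since ranks of codes are below
that number. -/
theorem Codes.position_lt (hq : 0 < q) (ha : Codes n q k a) {v : ℕ} (hv : v ≤ n) :
    position mem q k a v < q.choose k ^ countBelow mem v := by
  induction v with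
  | zero => simp [position, countBelow]
  | succ v ih =>
    have h1 := ih (by omega)
    have h2 := rank_lt_choose hq (ha v (by omega)).2 (ha v (by omega)).1
    rw [position_succ, countBelow_succ]
    by_cases hm : mem v
    · rw [ind_true hm, one_mul, pow_succ, mul_comm (_ ^ _)]
      have := Nat.mul_le_mul_right (q.choose k ^ countBelow mem v) (Nat.succ_le_of_lt h2)
      rw [Nat.succ_mul] at this
      omega
    · rw [ind_false hm]
      simpa using h1

theorem Codes.eq_of_position_eq (hq : 0 < q) (ha : Codes n q k a) (hb : Codes n q k b) {v : ℕ}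
    (hv : v ≤ n) (h : position mem q k a v = position mem q k b v) :
    ∀ u < v, mem u → a u = b u := by
  induction v with
  | zero => intro u hu; omega
  | succ v ih =>
    have ha' := ha.position_lt (mem := mem) hq (v := v) (by omega)
    have hb' := hb.position_lt (mem := mem) hq (v := v) (by omega)
    rw [position_succ, position_succ] at h
    set B := q.choose k ^ countBelow mem v
    have hB : 0 < B := by omega
    have key : position mem q k a v = position mem q k b v ∧
        (mem v → rank q k (a v) = rank q k (b v)) := by
      by_cases hm : mem v
      · rw [ind_true hm, one_mul, one_mul] at h
        -- Remainder and quotient by the weight `B` separate the lower digits from the digit of `v`.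
        have h1 := congrArg (· % B) h
        have h2 := congrArg (· / B) h
        simp only [Nat.add_mul_mod_self_right, Nat.mod_eq_of_lt ha', Nat.mod_eq_of_lt hb',
          Nat.add_mul_div_right _ _ hB, Nat.div_eq_of_lt ha', Nat.div_eq_of_lt hb', zero_add]
          at h1 h2
        exact ⟨h1, fun _ => h2⟩
      · rw [ind_false hm] at h
        exact ⟨by simpa using h, fun h' => absurd h' hm⟩
    intro u hu hm
    rcases Nat.lt_succ_iff_lt_or_eq.1 hu with h' | rfl
    · exact ih (by omega) key.1 u h' hm
    · exact rank_injective (ha u (by omega)).2 (hb u (by omega)).2 (key.2 hm)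

end Rank

/-- The body of the loop in `incP`. -/
def carryP (o k : ℕ) : WProg :=
  .branch (.op .mul (memE o (.reg 5)) (.reg 4))
    (.seq (.assign 8 (.op .add (.load (.reg 5)) (.lit 1))) (.seq (scanP k)
      (.seq (.branch (.op .lt (.reg 8) (.reg 3)) (.assign 4 (.lit 0)) (.assign 8 (.reg 12)))
        (.store (.reg 5) (.reg 8))))) .skip

/-- Move on to the next coloring of the feedback vertex set; register `4` tells whether the
enumeration has started anew. -/
def incP (o k : ℕ) : WProg := .seq (.assign 4 (.lit 1)) (.forLoop 5 2 (carryP o k))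

/-! ### The odometer over the colorings of the feedback vertex set -/

section Enumeration

/-- One digit of the increment. The carry at `v` is worth `q.choose k ^ countBelow mem v`; the
invariant is that the processed digits together with the carry represent the number `b`. -/
theorem carry_runs (o k : ℕ) : ∃ c, ∀ {i M n q K adj mem σ},
    Fit M o n q k i K adj mem → Base n q K σ → Codes n q k σ.mem →
    ∀ {f v b : ℕ} {p : Prop}, f < K → IsCode q k f → rank q k f = 0 → σ.regs 12 = f →
    v < n → σ.regs 5 = v → σ.regs 4 = ind p →
    position mem q k σ.mem v + ind p * q.choose k ^ countBelow mem v = b →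
    (carryP o k).Runs M σ (c * K) (fun τ => Codes n q k τ.mem ∧
      (∀ u < n, v < u → τ.mem u = σ.mem u) ∧ ∃ p' : Prop, τ.regs 4 = ind p' ∧
      position mem q k τ.mem (v + 1) + ind p' * q.choose k ^ countBelow mem (v + 1) =
        b + ind (mem v) * (rank q k (σ.mem v) * q.choose k ^ countBelow mem v)) := by
  refine ⟨(WExpr.op .mul (memE o (.reg 5)) (.reg 4)).cost + 1 +
    ((5 + ((2 * (codeE k (.reg 8)).cost + 40) + 20)) + 1), ?_⟩
  intro i M n q K adj mem σ hM hB hC f v b p hfK hf hf0 h12 hv hr5 hr4 hpos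
  have hK := hM.K_pos
  have hKw := hM.K_lt
  have hnw := hM.n_lt
  have hpow := hM.pow_eq
  have h5 : (WExpr.reg 5).HasVal M σ v := .reg hr5 (by omega)
  obtain ⟨hvK, hvc⟩ := hC v hv
  refine (WProg.Runs.branch (T := (5 + ((2 * (codeE k (.reg 8)).cost + 40) + 20)) * K) (T' := 1)
    (WExpr.HasVal.mul_ind (hM.val_mem h5 hv) (hM.val_ind hr4) hM.one_lt) ?_ ?_).mono
    (add_le_add_mul (le_mul_of_one_le _ hK) (add_le_add_mul le_rfl (by omega))) fun _ h => h
  · rintro ⟨hm, hp⟩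
    rw [ind_true hp, one_mul] at hpos
    refine (WProg.Runs.seq (T' := ((2 * (codeE k (.reg 8)).cost + 40) + 20) * K)
      (Q₁ := fun τ => τ = σ.setReg 8 (σ.mem v + 1))
      (.assign (.add (hM.val_load_code (a := σ.mem) (fun _ _ => rfl)
        (fun u hu => hpow ▸ (hC u hu).1) h5 hv) (.lit hM.one_lt) (by omega)) rfl) ?_).mono
      (add_le_add_mul (by simp [WExpr.cost]; omega) le_rfl) fun _ h => h
    rintro _ rfl
    have hB1 : Base n q K (σ.setReg 8 (σ.mem v + 1)) :=
      hB.congr (by simp) (by simp) (by simp)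
    refine (WProg.Runs.seq (T' := 20) (hM.scan_runs hB1 (y₀ := σ.mem v + 1) (by simp)
      (by omega)).frame ?_).mono (add_le_add_mul le_rfl (le_mul_of_one_le _ hK)) fun _ h => h
    rintro τ ⟨⟨hmem, y, hyK, hy0, hr8, hno, hyc⟩, hk⟩
    have hkeep : ∀ z ≠ 8, τ.regs z = σ.regs z := fun z hz => by
      rw [hk z (by simp [scanP, WProg.Keeps, hz])]; simp [hz]
    have hB2 : Base n q K τ := hB.congr (hkeep 1 (by simp)) (hkeep 2 (by simp))
      (hkeep 3 (by simp))
    have h8 : (WExpr.reg 8).HasVal M τ y := .reg hr8 (by omega)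
    rw [WState.setReg_mem] at hmem
    have hrank : rank q k y = rank q k (σ.mem v) + 1 := by
      rw [rank_eq_of_forall_not_isCode hy0 hno, rank_succ_of_isCode hvc]
    -- Advancing to the next code and wrapping around to the first one end in the same store; both
    -- only have to verify the same identity between digit and carry.
    have hstore : ∀ (τ' : WState) (x : ℕ), τ'.mem = σ.mem → τ'.regs 8 = x → τ'.regs 5 = v →
        x < K → IsCode q k x → ∀ p' : Prop, τ'.regs 4 = ind p' →
        rank q k x * q.choose k ^ countBelow mem v +
          ind p' * q.choose k ^ countBelow mem (v + 1) =
          q.choose k ^ countBelow mem v + rank q k (σ.mem v) * q.choose k ^ countBelow mem v →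
        (WProg.store (.reg 5) (.reg 8)).Runs M τ' 3 (fun τ => Codes n q k τ.mem ∧
          (∀ u < n, v < u → τ.mem u = σ.mem u) ∧ ∃ p' : Prop, τ.regs 4 = ind p' ∧
          position mem q k τ.mem (v + 1) + ind p' * q.choose k ^ countBelow mem (v + 1) =
            b + ind (mem v) * (rank q k (σ.mem v) * q.choose k ^ countBelow mem v)) := by
      intro τ' x hm' hx8 hx5 hxK hxc p' hp' heq
      refine hM.store_code (.reg hx5 (by omega)) hv hxK (.reg hx8 (by omega)) ⟨?_, ?_, p', hp', ?_⟩
      · intro u hu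
        rw [WState.setMem_mem, hm']
        split_ifs
        · exact ⟨hpow ▸ hxK, hxc⟩
        · exact hC u hu
      · intro u hu huv
        rw [WState.setMem_mem, if_neg (by omega), hm']
      · have h1 : position mem q k (τ'.setMem v x).mem v = position mem q k σ.mem v :=
          position_congr fun u hu => by rw [WState.setMem_mem, if_neg (by omega), hm']
        rw [position_succ, h1, ind_true hm, one_mul, one_mul, WState.setMem_mem, if_pos rfl]
        omega
    refine (WProg.Runs.seq (T' := 3) (WProg.Runs.branch (c := y < K) (T := 2) (T' := 2)
      (Q := fun τ' => τ'.mem = σ.mem ∧ τ'.regs 5 = v ∧ ∃ x p', τ'.regs 8 = x ∧ x < K ∧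
        IsCode q k x ∧ τ'.regs 4 = ind p' ∧ rank q k x * q.choose k ^ countBelow mem v +
          ind p' * q.choose k ^ countBelow mem (v + 1) =
          q.choose k ^ countBelow mem v + rank q k (σ.mem v) * q.choose k ^ countBelow mem v)
      (.lt_ind h8 (hM.val_K hB2) hM.one_lt) ?_ ?_) ?_).mono (by simp [WExpr.cost]) fun _ h => h
    · intro hy
      refine .assign (.lit (by omega)) ⟨hmem, by simp [hkeep, hr5], y, False, by simp [hr8], hy,
        hyc hy, by simp [ind_false], ?_⟩
      rw [hrank, ind_false not_false]
      ring
    · intro hy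
      -- No code follows, so the old rank plus one is `q.choose k`; the digit returns to rank zero
      -- and the carry moves on.
      obtain rfl : y = K := by omega
      have hf' : f < 2 ^ M.w := by omega
      refine .assign (.reg (a := f) (by rw [hkeep 12 (by simp), h12]) hf') ⟨hmem, by simp [hkeep, hr5],
        f, True, by simp, hfK, hf, by simp [hkeep, hr4, ind_true, hp], ?_⟩
      rw [← hpow, rank_pow hM.q_pos] at hrank
      rw [hf0, ind_true trivial, countBelow_succ, ind_true hm, pow_succ]
      have key : ∀ B, 0 * B + 1 * (B * q.choose k) = B + rank q k (σ.mem v) * B := by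
        intro B
        rw [hrank]
        ring
      exact key _
    · rintro τ' ⟨h1, h2, x, p', h3, h4, h5, h6, h7⟩
      exact hstore τ' x h1 h3 h2 h4 h5 p' h6 h7
  · intro hc
    refine .skip ⟨hC, fun _ _ _ => rfl, p, hr4, ?_⟩
    rw [position_succ, countBelow_succ]
    by_cases hm : mem v
    · have hp : ¬p := fun hp => hc ⟨hm, hp⟩
      rw [ind_false hp] at hpos ⊢
      omega
    · rw [ind_false hm, add_zero, zero_mul]
      omega

/-- The position grows by one, except that a carry out of the last digit turns the largest position
into zero. -/
theorem inc_runs (o k : ℕ) : ∃ c, ∀ {i M n q K adj mem σ},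
    Fit M o n q k i K adj mem → Base n q K σ → Codes n q k σ.mem →
    ∀ {f : ℕ}, f < K → IsCode q k f → rank q k f = 0 → σ.regs 12 = f →
    (incP o k).Runs M σ (c * (K * n)) (fun τ => Codes n q k τ.mem ∧
      ∃ p : Prop, τ.regs 4 = ind p ∧
      position mem q k τ.mem n + ind p * q.choose k ^ countBelow mem n =
        position mem q k σ.mem n + 1) := by
  obtain ⟨C, hC⟩ := carry_runs o k
  refine ⟨2 + (2 * C + 20), ?_⟩
  intro i M n q K adj mem σ hM hB hcod f hfK hf hf0 h12
  have hK := hM.K_pos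
  have hn := hM.n_pos
  have hnw := hM.n_lt
  refine (WProg.Runs.seq (T' := (2 * C + 20) * (K * n)) (Q₁ := fun τ => τ = σ.setReg 4 1)
    (.assign (.lit hM.one_lt) rfl) ?_).mono
    (add_le_add_mul (le_mul_of_one_le _ (Nat.mul_pos hK hn)) le_rfl) fun _ h => h
  rintro _ rfl
  have hkeep : ∀ z, z ≠ 4 → z ≠ 8 → (carryP o k).Keeps z := by
    intro z h4 h8
    simp [carryP, scanP, WProg.Keeps, h4, h8]
  refine (WProg.Runs.forLoop (fun j τ => Codes n q k τ.mem ∧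
    (∀ u < n, j ≤ u → τ.mem u = σ.mem u) ∧ ∃ p : Prop, τ.regs 4 = ind p ∧
      position mem q k τ.mem j + ind p * q.choose k ^ countBelow mem j =
        position mem q k σ.mem j + 1) (N := n) (by simp [hB.reg_n]) (by omega)
    (hkeep 5 (by simp) (by simp)) (hkeep 2 (by simp) (by simp)) (by simp) hK hn le_rfl
    ?_ ?_).mono le_rfl fun _ h => ⟨h.1.1, h.1.2.2⟩
  · exact ⟨hcod, fun _ _ _ => rfl, True, by simp [ind_true],
      by simp [position, countBelow, ind_true]⟩
  · rintro v hv τ ⟨h1, h2, p, h3, h4⟩ hr5 hk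
    have hk' : ∀ z, z ≠ 4 → z ≠ 8 → z ≠ 5 → τ.regs z = σ.regs z := fun z hz4 hz8 hz5 => by
      rw [hk z (hkeep z hz4 hz8) hz5]; simp [hz4]
    have hB1 : Base n q K τ := hB.congr (hk' 1 (by simp) (by simp) (by simp))
      (hk' 2 (by simp) (by simp) (by simp)) (hk' 3 (by simp) (by simp) (by simp))
    refine (hC hM hB1 h1 hfK hf hf0 ((hk' 12 (by simp) (by simp) (by simp)).trans h12) hv hr5 h3
      h4).mono le_rfl ?_
    rintro τ' ⟨h5, h6, p', h7, h8⟩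
    refine ⟨h5, fun u hu huv => ?_, p', by simpa using h7, ?_⟩
    · rw [WState.setReg_mem, h6 u hu (by omega), h2 u hu (by omega)]
    · rw [WState.setReg_mem, h8, h2 v hv le_rfl, position_succ]
      ring

/-- Try all colorings of the feedback vertex set. -/
def enumP (o k i : ℕ) : WProg :=
  .seq (.assign 4 (.lit 0)) (.loop (WExpr.reg 4).neg (.seq (testP o k i) (incP o k)))

theorem Extends.congr {adj : ℕ → ℕ → Prop} {mem : ℕ → Prop} {n q k i : ℕ} {a b : ℕ → ℕ}
    (h : Extends adj mem n q k i a) (hab : ∀ v < n, mem v → a v = b v) :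
    Extends adj mem n q k i b := by
  obtain ⟨g, h1, h2⟩ := h
  exact ⟨g, h1, fun v hv hm => (h2 v hv hm).trans (hab v hv hm)⟩

theorem enum_runs (o k i : ℕ) : ∃ c, ∀ {M n q K adj mem σ},
    Fit M o n q k i K adj mem → Base n q K σ → (∀ u v, adj u v → adj v u) → (∀ v, ¬adj v v) →
    IsForest n (forestAdj adj mem) → Codes n q k σ.mem → (∀ v < n, σ.mem v = σ.regs 12) →
    rank q k (σ.regs 12) = 0 → σ.regs 0 = 0 →
    (enumP o k i).Runs M σ (c * (q.choose k ^ countBelow mem n * (K * K * n * n * n)))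
      (fun τ => τ.regs 0 = ind (∃ h, IsCodeColoring adj n q k i h)) := by
  obtain ⟨c₁, h₁⟩ := test_runs o k i
  obtain ⟨c₂, h₂⟩ := inc_runs o k
  refine ⟨2 + 2 * (c₁ + c₂ + 4), ?_⟩
  intro M n q K adj mem σ hM hB hs hi hF hcod hf hf0 hr0
  have hn := hM.n_pos
  have hK := hM.K_pos
  have hpow := hM.pow_eq
  set N := q.choose k ^ countBelow mem n with hN
  set A := K * K * n * n * n with hA
  have hN1 : 1 ≤ N := Nat.one_le_pow _ _ (Nat.choose_pos hM.k_le)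
  have hA1 : 1 ≤ A := Nat.mul_pos (Nat.mul_pos (Nat.mul_pos (Nat.mul_pos hK hK) hn) hn) hn
  have hKn : K * n ≤ A := by
    have : 1 ≤ K * n * n := Nat.mul_pos (Nat.mul_pos hK hn) hn
    calc K * n = (K * n) * 1 := (mul_one _).symm
      _ ≤ (K * n) * (K * n * n) := Nat.mul_le_mul_left _ this
      _ = _ := by rw [hA]; ring
  have hfc := hcod 0 (by omega)
  rw [hf 0 (by omega), hpow] at hfc
  refine (WProg.Runs.seq (T' := 2 * (c₁ + c₂ + 4) * (N * A)) (Q₁ := fun τ => τ = σ.setReg 4 0)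
    (.assign (.lit (by have := hM.one_lt; omega)) rfl) ?_).mono
    (add_le_add_mul (le_mul_of_one_le _ (Nat.mul_pos hN1 hA1)) le_rfl) fun _ h => h
  rintro _ rfl
  have hkeep : ∀ z, (z ≠ 0 ∧ z < 4) ∨ 11 < z → ((testP o k i).seq (incP o k)).Keeps z := by
    intro z hz
    refine ⟨keeps_testP (by omega) (by omega), ?_⟩
    simp only [incP, carryP, scanP, WProg.Keeps, WProg.keeps_forLoop, and_true]
    omega
  -- Round `j` treats the coloring at position `j`. Register `0` records whether any coloring of
  -- smaller position extends; the carry in register `4` signals `j = N`.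
  refine (WProg.Runs.loop (T := (c₁ + c₂) * A) (fun j τ => Codes n q k τ.mem ∧
    τ.regs 0 = ind (∃ b, Codes n q k b ∧ position mem q k b n < j ∧ Extends adj mem n q k i b) ∧
    ∃ p : Prop, τ.regs 4 = ind p ∧ position mem q k τ.mem n + ind p * N = j) (N := N)
    ?_ ?_ ?_).mono ?_ ?_
  · refine ⟨hcod, ?_, False, by simp [ind_false], ?_⟩
    · simp [hr0, ind_false]
    · rw [ind_false not_false, zero_mul, add_zero, WState.setReg_mem]
      refine Finset.sum_eq_zero fun u hu => ?_
      rw [hf u (Finset.mem_range.1 hu), hf0, zero_mul, mul_zero]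
  · rintro j hj τ ⟨h1, h2, p, h3, h4⟩ hk
    refine (WExpr.HasVal.neg (hM.val_ind h3) hM.one_lt).congr (ind_congr ?_)
    -- Positions are below `N`, so the carry is set exactly when `j = N`.
    have := h1.position_lt (mem := mem) hM.q_pos le_rfl
    by_cases hp : p
    · rw [ind_true hp] at h4
      simp only [hp, not_true, false_iff]
      omega
    · rw [ind_false hp] at h4
      simp only [hp, not_false_iff, true_iff]
      omega
  · rintro j hj τ ⟨h1, h2, p, h3, h4⟩ hk
    have hk' : ∀ z, (z ≠ 0 ∧ z < 4) ∨ 11 < z → τ.regs z = σ.regs z := fun z hz => by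
      rw [hk z (hkeep z hz), WState.setReg_regs, if_neg (by omega)]
    have hB1 : Base n q K τ := hB.congr (hk' 1 (by simp)) (hk' 2 (by simp)) (hk' 3 (by simp))
    have hp : ¬p := by
      intro hp
      rw [ind_true hp] at h4
      omega
    rw [ind_false hp, zero_mul, add_zero] at h4
    refine (WProg.Runs.seq (T' := c₂ * A) (h₁ hM hB1 hs hi hF (a := τ.mem) (fun _ _ => rfl)
      (fun v hv => hpow ▸ (h1 v hv).1) h2).frame ?_).mono (by rw [Nat.add_mul]) fun _ h => h
    rintro τ' ⟨⟨h5, h6⟩, hk2⟩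
    have hk2' : ∀ z, (z ≠ 0 ∧ z < 4) ∨ 11 < z → τ'.regs z = σ.regs z := fun z hz => by
      rw [hk2 z (hkeep z hz).1, hk' z hz]
    have hB2 : Base n q K τ' := hB.congr (hk2' 1 (by simp)) (hk2' 2 (by simp)) (hk2' 3 (by simp))
    refine (h₂ hM hB2 (fun v hv => by rw [h5 v hv]; exact h1 v hv) hfc.1 hfc.2 hf0
      (hk2' 12 (by simp))).frame.mono (Nat.mul_le_mul_left _ hKn) ?_
    rintro ρ ⟨⟨h7, p', h8, h9⟩, hk3⟩
    refine ⟨h7, ?_, p', h8, ?_⟩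
    · rw [hk3 0 (by simp [incP, carryP, scanP, WProg.Keeps, WProg.keeps_forLoop]), h6]
      refine ind_congr ⟨?_, ?_⟩
      · rintro (⟨b, h10, h11, h12⟩ | h10)
        · exact ⟨b, h10, by omega, h12⟩
        · exact ⟨τ.mem, h1, by omega, h10⟩
      · rintro ⟨b, h10, h11, h12⟩
        by_cases hj' : position mem q k b n < j
        · exact Or.inl ⟨b, h10, hj', h12⟩
        -- A coloring at the current position agrees with the stored one on `S`, and only the values
        -- on `S` matter for an extension.
        · exact Or.inr (h12.congr (h10.eq_of_position_eq hM.q_pos h1 le_rfl (by omega)))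
    · rw [hN, h9, position_congr (b := τ.mem) h5, h4]
  · simp only [WExpr.neg, WExpr.cost]
    calc (N + 1) * ((c₁ + c₂) * A + (1 + 1 + 1) + 1)
        ≤ (2 * N) * ((c₁ + c₂) * A + 4 * A) := Nat.mul_le_mul (by omega) (by omega)
      _ = 2 * (c₁ + c₂ + 4) * (N * A) := by ring
  · rintro τ ⟨⟨-, h, -⟩, -⟩
    rw [h]
    refine ind_congr ⟨?_, ?_⟩
    · rintro ⟨b, -, -, g, h1, -⟩
      exact ⟨g, h1⟩
    · rintro ⟨g, hg⟩
      -- A proper coloring is found when its own restriction to `S` is tried.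
      exact ⟨g, hg.1, Codes.position_lt hM.q_pos hg.1 le_rfl, g, hg, fun _ _ _ => rfl⟩

/-- Decide, for the number of colors in register `1`, whether there is a proper coloring. -/
def decideP (o k i : ℕ) : WProg :=
  .seq (.assign 2 (.input (.lit o))) (.seq (.assign 3 (WExpr.pow (.reg 1) k))
    (.seq (.assign 0 (.lit 0)) (.seq (.assign 8 (.lit 0)) (.seq (scanP k)
      (.seq (.assign 12 (.reg 8)) (.seq (.forLoop 5 2 (.store (.reg 5) (.reg 12)))
        (enumP o k i)))))))

theorem keeps_decideP {o k i z : ℕ} (hz : z = 1 ∨ 12 < z) : (decideP o k i).Keeps z := by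
  simp only [decideP, enumP, WProg.Keeps, WProg.keeps_forLoop, incP, carryP, scanP, and_true]
  have := @keeps_testP o k i z (by omega)
  have h0 : z ≠ 0 := by omega
  refine ⟨?_, ?_, ?_, ?_, ?_, ?_, ?_, ?_, this h0, ?_⟩ <;> omega

/-- Apart from register `1`, nothing is assumed about registers and memory: all that is read has
been initialized. Hence the program can be run repeatedly on the same machine. -/
theorem decide_runs (o k i : ℕ) : ∃ c, ∀ {M n q K adj mem σ},
    Fit M o n q k i K adj mem → σ.regs 1 = q → (∀ u v, adj u v → adj v u) → (∀ v, ¬adj v v) →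
    IsForest n (forestAdj adj mem) →
    (decideP o k i).Runs M σ (c * (q.choose k ^ countBelow mem n * (K * K * n * n * n)))
      (fun τ => τ.regs 0 = ind (∃ h, IsCodeColoring adj n q k i h)) := by
  obtain ⟨c₁, h₁⟩ := enum_runs o k i
  refine ⟨3 + (((WExpr.reg 1).pow k).cost + 1 + (2 + (2 + ((2 * (codeE k (.reg 8)).cost + 40) +
    (2 + ((2 * 3 + 20) + c₁)))))), ?_⟩
  intro M n q K adj mem σ hM hq hs hi hF
  have hn := hM.n_pos
  have hK := hM.K_pos
  have hnw := hM.n_lt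
  have hKw := hM.K_lt
  have hpow := hM.pow_eq
  set A := q.choose k ^ countBelow mem n * (K * K * n * n * n) with hA
  have hN1 : 1 ≤ q.choose k ^ countBelow mem n := Nat.one_le_pow _ _ (Nat.choose_pos hM.k_le)
  have hA1 : 1 ≤ A := Nat.mul_pos hN1
    (Nat.mul_pos (Nat.mul_pos (Nat.mul_pos (Nat.mul_pos hK hK) hn) hn) hn)
  have hKn : K * n ≤ A := by
    have : 1 ≤ q.choose k ^ countBelow mem n * (K * n * n) :=
      Nat.mul_pos hN1 (Nat.mul_pos (Nat.mul_pos hK hn) hn)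
    calc K * n = (K * n) * 1 := (mul_one _).symm
      _ ≤ (K * n) * (q.choose k ^ countBelow mem n * (K * n * n)) := Nat.mul_le_mul_left _ this
      _ = _ := by rw [hA]; ring
  have hKA : K ≤ A := (Nat.le_mul_of_pos_right K hn).trans hKn
  have hnA : n ≤ A := (Nat.le_mul_of_pos_left n hK).trans hKn
  have hoff := hM.word_input
  refine (WProg.Runs.seq (T' := (((WExpr.reg 1).pow k).cost + 1 + (2 + (2 +
    ((2 * (codeE k (.reg 8)).cost + 40) + (2 + ((2 * 3 + 20) + c₁)))))) * A)
    (Q₁ := fun τ => τ = σ.setReg 2 n)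
    (.assign (.input (.lit (by omega)) hM.input_n (by omega)) rfl) ?_).mono
    (add_le_add_mul (le_mul_of_one_le _ hA1) le_rfl) fun _ h => h
  rintro _ rfl
  refine (WProg.Runs.seq (T' := (2 + (2 + ((2 * (codeE k (.reg 8)).cost + 40) +
    (2 + ((2 * 3 + 20) + c₁))))) * A)
    (Q₁ := fun τ => τ = (σ.setReg 2 n).setReg 3 K)
    (.assign ((WExpr.HasVal.pow hM.q_pos (.reg (by simp [hq]) ?_) (by rw [hpow]; omega)).congr
      hpow) rfl) ?_).mono
    (add_le_add_mul (le_mul_of_one_le _ hA1) le_rfl) fun _ h => h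
  · have := hM.q_le
    omega
  rintro _ rfl
  refine (WProg.Runs.seq (T' := (2 + ((2 * (codeE k (.reg 8)).cost + 40) +
    (2 + ((2 * 3 + 20) + c₁)))) * A)
    (Q₁ := fun τ => τ = ((σ.setReg 2 n).setReg 3 K).setReg 0 0)
    (.assign (.lit (by omega)) rfl) ?_).mono
    (add_le_add_mul (le_mul_of_one_le _ hA1) le_rfl) fun _ h => h
  rintro _ rfl
  refine (WProg.Runs.seq (T' := ((2 * (codeE k (.reg 8)).cost + 40) +
    (2 + ((2 * 3 + 20) + c₁))) * A)
    (Q₁ := fun τ => τ = (((σ.setReg 2 n).setReg 3 K).setReg 0 0).setReg 8 0)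
    (.assign (.lit (by omega)) rfl) ?_).mono
    (add_le_add_mul (le_mul_of_one_le _ hA1) le_rfl) fun _ h => h
  rintro _ rfl
  have hB : Base n q K ((((σ.setReg 2 n).setReg 3 K).setReg 0 0).setReg 8 0) :=
    ⟨by simp [hq], by simp, by simp⟩
  refine (WProg.Runs.seq (T' := (2 + ((2 * 3 + 20) + c₁)) * A)
    (hM.scan_runs hB (y₀ := 0) (by simp) (by omega)).frame ?_).mono
    (add_le_add_mul (Nat.mul_le_mul_left _ hKA) le_rfl) fun _ h => h
  rintro τ ⟨⟨-, f, hfK, -, hr8, hno, hfc⟩, hk⟩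
  have hkeep : ∀ z ≠ 8, (scanP k).Keeps z := fun z hz => by simp [scanP, WProg.Keeps, hz]
  have hB1 : Base n q K τ := hB.congr (hk 1 (hkeep 1 (by simp))) (hk 2 (hkeep 2 (by simp)))
    (hk 3 (hkeep 3 (by simp)))
  have hr0 : τ.regs 0 = 0 := by rw [hk 0 (hkeep 0 (by simp))]; simp
  have hf0 : rank q k f = 0 := by
    rw [rank_eq_of_forall_not_isCode (Nat.zero_le f) hno]
    simp [rank]
  -- Since `k ≤ q` there is at least one code, so the scan from `0` finds one.
  have hfK' : f < K := by
    by_contra h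
    obtain rfl : f = K := by omega
    rw [← hpow, rank_pow hM.q_pos] at hf0
    exact absurd hf0 (Nat.choose_pos hM.k_le).ne'
  refine (WProg.Runs.seq (T' := ((2 * 3 + 20) + c₁) * A) (Q₁ := fun ρ => ρ = τ.setReg 12 f)
    (.assign (.reg hr8 (by omega)) rfl) ?_).mono
    (add_le_add_mul (le_mul_of_one_le _ hA1) le_rfl) fun _ h => h
  rintro _ rfl
  have hB2 : Base n q K (τ.setReg 12 f) := hB1.congr (by simp) (by simp) (by simp)
  refine (WProg.Runs.seq (T' := c₁ * A) (WProg.Runs.forLoop (c := 3)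
    (fun j ρ => ∀ v < j, ρ.mem v = f) hB2.reg_n (by omega) (by simp [WProg.Keeps])
    (by simp [WProg.Keeps]) (by simp) le_rfl hn le_rfl (fun v hv => absurd hv (by omega)) ?_)
    ?_).mono (add_le_add_mul (Nat.mul_le_mul_left _ (by omega)) le_rfl) fun _ h => h
  · intro v hv ρ hI hr5 hk2
    have h12 : ρ.regs 12 = f := by rw [hk2 12 (by simp [WProg.Keeps]) (by simp)]; simp
    refine hM.store_code (.reg hr5 (by omega)) hv hfK' (.reg h12 (by omega)) ?_
    intro u hu
    rw [WState.setReg_mem, WState.setMem_mem]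
    split_ifs with h
    · rfl
    · exact hI u (by omega)
  · rintro ρ ⟨hI, hk2⟩
    have hB3 : Base n q K ρ := hB2.congr (hk2 1 (by simp [WProg.Keeps]) (by simp))
      (hk2 2 (by simp [WProg.Keeps]) (by simp)) (hk2 3 (by simp [WProg.Keeps]) (by simp))
    have h12 : ρ.regs 12 = f := by rw [hk2 12 (by simp [WProg.Keeps]) (by simp)]; simp
    have h0 : ρ.regs 0 = 0 := by
      rw [hk2 0 (by simp [WProg.Keeps]) (by simp)]; simp [hr0]
    refine h₁ hM hB3 hs hi hF ?_ ?_ ?_ h0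
    · intro v hv
      rw [hI v hv]
      exact ⟨hpow ▸ hfK', hfc hfK'⟩
    · intro v hv
      rw [hI v hv, h12]
    · rw [h12, hf0]

end Enumeration

/-! ### The input -/

section Input

variable {n : ℕ} (G : SimpleGraph (Fin n)) (S : Finset (Fin n))

theorem encodeGraph_getD_mem {v : ℕ} (hv : v < n) :
    (encodeGraph G S).getD (1 + v) 0 = ind (natMem S v) := by
  rw [encodeGraph, add_comm, List.getD_cons_succ, List.getD_append _ _ _ _ (by simpa using hv),
    List.getD_eq_getElem _ _ (by simpa using hv), List.getElem_ofFn, ite_eq_ind]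
  exact ind_congr ⟨fun h => ⟨hv, h⟩, fun ⟨_, h⟩ => h⟩

theorem encodeGraph_getD_adj {u v : ℕ} (hu : u < n) (hv : v < n) :
    (encodeGraph G S).getD (1 + (n + (u * n + v))) 0 = ind (natAdj G u v) := by
  have h1 := row_lt hu hv
  rw [encodeGraph, add_comm, List.getD_cons_succ, List.getD_append_right _ _ _ _ (by simp),
    List.length_ofFn, Nat.add_sub_cancel_left, List.getD_eq_getElem _ _ (by simpa using h1),
    List.getElem_ofFn, ite_eq_ind]
  have h2 : (⟨u * n + v, h1⟩ : Fin (n * n)).divNat = ⟨u, hu⟩ := by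
    refine Fin.ext ?_
    simp only [Fin.coe_divNat]
    rw [mul_comm, Nat.mul_add_div (by omega), Nat.div_eq_of_lt hv, add_zero]
  have h3 : (⟨u * n + v, h1⟩ : Fin (n * n)).modNat = ⟨v, hv⟩ := by
    refine Fin.ext ?_
    simp only [Fin.coe_modNat]
    rw [mul_comm, Nat.mul_add_mod, Nat.mod_eq_of_lt hv]
  rw [h2, h3]
  exact ind_congr ⟨fun h => ⟨hu, hv, h⟩, fun ⟨_, _, h⟩ => h⟩

/-- Identifies the number of digits of the odometer with the exponent `|S|` of the running time. -/
theorem countBelow_natMem : countBelow (natMem S) n = S.card := by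
  classical
  rw [countBelow, Finset.sum_range, ← Finset.filter_univ_mem S, Finset.card_filter]
  refine Finset.sum_congr rfl fun v _ => ?_
  rw [ite_eq_ind]
  exact ind_congr ⟨fun ⟨_, h⟩ => by simpa using h, fun h => ⟨v.2, by simpa using h⟩⟩

theorem natAdj_symm (u v : ℕ) (h : natAdj G u v) : natAdj G v u := by
  obtain ⟨hu, hv, h⟩ := h
  exact ⟨hv, hu, h.symm⟩

theorem natAdj_irrefl (v : ℕ) : ¬natAdj G v v := fun ⟨_, _, h⟩ => h.ne rfl

end Input

/-! ### Word length -/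

theorem word_bounds {X n q k i w o : ℕ} (hX : 2 ≤ X) (hn : n < X) (hq : q < X) (ho : o ≤ 1)
    (hw : X ^ (k + 5 + (k * k + i)) ≤ 2 ^ w) :
    o + 1 + (n + n * n) < 2 ^ w ∧ n + n + n * q ^ k + 2 < 2 ^ w ∧ k * k + i + 2 < 2 ^ w := by
  have hX0 : 0 < X := by omega
  -- The factor `X ^ (k + 5)` of the word range accommodates addresses into the input and the table,
  -- the other factor the constant `k * k + i`.
  have h1 : X ^ (k + 5) ≤ 2 ^ w := (Nat.pow_le_pow_right hX0 (by omega)).trans hw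
  have h2 : X ^ 5 ≤ X ^ (k + 5) := Nat.pow_le_pow_right hX0 (by omega)
  have h3 : 2 ^ (k * k + i + 5) ≤ 2 ^ w :=
    ((Nat.pow_le_pow_left hX _).trans (Nat.pow_le_pow_right hX0 (by omega))).trans hw
  have h4 : k * k + i + 5 < 2 ^ (k * k + i + 5) := Nat.lt_two_pow_self
  have h5 : q ^ k ≤ X ^ k := Nat.pow_le_pow_left hq.le k
  have h6 : 1 ≤ X ^ k := Nat.one_le_pow _ _ hX0
  have h7 : n * n ≤ X * X := Nat.mul_le_mul hn.le hn.le
  have h8 : n * q ^ k ≤ X * X ^ k := Nat.mul_le_mul hn.le h5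
  have h9 : 2 * 2 ≤ X * X := Nat.mul_le_mul hX hX
  have h10 : 2 * X ≤ X * X := Nat.mul_le_mul_right X hX
  have h11 : 4 * (X * X) ≤ X * X * (X * X) := Nat.mul_le_mul_right _ h9
  have h12 : 2 * (X * X * (X * X)) ≤ X ^ 5 := by
    calc 2 * (X * X * (X * X)) ≤ X * (X * X * (X * X)) := Nat.mul_le_mul_right _ hX
      _ = X ^ 5 := by ring
  refine ⟨by omega, ?_, by omega⟩
  have h13 : X * 1 ≤ X * X ^ k := Nat.mul_le_mul_left X h6
  have h14 : 16 * (X * X ^ k) ≤ X ^ (k + 5) := by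
    calc 16 * (X * X ^ k) ≤ (X * X * (X * X)) * (X * X ^ k) := Nat.mul_le_mul_right _ (by omega)
      _ = X ^ (k + 5) := by ring
  omega

/-! ### Computability of the parameter function -/

theorem Primrec.nat_pow {g h : ℕ → ℕ} (hg : Primrec g) (hh : Primrec h) :
    Primrec fun s => g s ^ h s := by
  refine (Primrec.nat_rec' (f := h) (g := fun _ => 1) (h := fun s p => p.2 * g s) hh
    (Primrec.const 1) ?_).of_eq fun s => ?_
  · exact Primrec.nat_mul.comp (Primrec.snd.comp Primrec.snd) (hg.comp Primrec.fst)
  · induction h s with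
    | zero => rfl
    | succ m ih => rw [pow_succ, ← ih]

theorem Primrec.nat_choose_const {g : ℕ → ℕ} (hg : Primrec g) (k : ℕ) :
    Primrec fun s => (g s).choose k := by
  induction k with
  | zero => exact (Primrec.const 1).of_eq fun s => (Nat.choose_zero_right _).symm
  | succ k ih =>
    -- The recursion `choose m (k + 1) = choose m k * (m - k) / (k + 1)`, which is primitive
    -- recursive for fixed `k`.
    refine (Primrec.nat_div.comp (Primrec.nat_mul.comp ih
      (Primrec.nat_sub.comp hg (Primrec.const k))) (Primrec.const (k + 1))).of_eq fun s => ?_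
    rw [← Nat.choose_succ_right_eq, Nat.mul_div_cancel _ (Nat.succ_pos k)]

theorem computable_choose_pow (c k : ℕ) :
    Computable fun s => c * (k * (s + 2)).choose k ^ (s + 2) := by
  have h1 : Primrec fun s : ℕ => s + 2 := Primrec.nat_add.comp Primrec.id (Primrec.const 2)
  have h2 : Primrec fun s : ℕ => k * (s + 2) := Primrec.nat_mul.comp (Primrec.const k) h1
  exact (Primrec.nat_mul.comp (Primrec.const c)
    ((Primrec.nat_choose_const h2 k).nat_pow h1)).to_comp

/-! ### The two programs -/

/-- The two factors `q ^ k`, from comparing the codes of a vertex with those of a neighbor, become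
the `+ 2` in the exponent. -/
theorem pow_mul_pow_le {q k s n : ℕ} (hk : 1 ≤ k) (hkq : k ≤ q) :
    q.choose k ^ s * (q ^ k * q ^ k * n * n * n) ≤
      (k ^ k * k.factorial) ^ 2 * (q.choose k ^ (s + 2) * n ^ 3) := by
  have h := pow_le_mul_choose hk hkq
  calc q.choose k ^ s * (q ^ k * q ^ k * n * n * n)
      = (q ^ k * q ^ k) * (q.choose k ^ s * n ^ 3) := by ring
    _ ≤ ((k ^ k * k.factorial * q.choose k) * (k ^ k * k.factorial * q.choose k)) *
        (q.choose k ^ s * n ^ 3) := Nat.mul_le_mul_right _ (Nat.mul_le_mul h h)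
    _ = _ := by ring

/-- Read the number of colors and decide. -/
def decisionP (k i : ℕ) : WProg := .seq (.assign 1 (.input (.lit 0))) (decideP 1 k i)

/-- The machine for the decision problem. -/
noncomputable def decisionM (b : ℕ) {n : ℕ} (G : SimpleGraph (Fin n)) (S : Finset (Fin n))
    (q k : ℕ) : WMachine where
  w := b * Nat.size (n * q)
  input := q :: encodeGraph G S
  cells := List.replicate n (k * Nat.size q) ++ List.replicate (n + n * q ^ k) 1

theorem size_le_self (m : ℕ) : Nat.size m ≤ m := Nat.size_le.2 Nat.lt_two_pow_self

theorem decisionM_fit {n : ℕ} (G : SimpleGraph (Fin n)) (S : Finset (Fin n)) {q k : ℕ} (i : ℕ)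
    (hk : 1 ≤ k) (hkq : k ≤ q) (hn : 1 ≤ n) :
    Fit (decisionM (k + 5 + (k * k + i)) G S q k) 1 n q k i (q ^ k) (natAdj G) (natMem S) := by
  have hlt : n * q < 2 ^ Nat.size (n * q) := Nat.lt_size_self _
  have h1 : n ≤ n * q := Nat.le_mul_of_pos_right n (by omega)
  have h2 : q ≤ n * q := Nat.le_mul_of_pos_left q hn
  obtain ⟨b1, b2, b3⟩ := word_bounds (X := 2 ^ Nat.size (n * q)) (n := n) (q := q) (k := k) (i := i)
    (o := 1) (w := (k + 5 + (k * k + i)) * Nat.size (n * q)) (by omega) (by omega) (by omega) le_rfl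
    (by rw [← pow_mul, mul_comm])
  refine ⟨hn, hk, hkq, rfl, rfl, fun v hv => ?_, fun u hu v hv => ?_, b1, b2, b3, fun v hv => ?_,
    fun v hv => ?_, fun v hv x hx => ?_⟩
  · rw [show 1 + 1 + v = (1 + v) + 1 by omega]
    exact encodeGraph_getD_mem G S hv
  · rw [show 1 + 1 + (n + (u * n + v)) = (1 + (n + (u * n + v))) + 1 by omega]
    exact encodeGraph_getD_adj G S hu hv
  · refine ⟨by simp [decisionM]; omega, ?_⟩
    simp only [decisionM]
    -- A cell of `k * Nat.size q` bits holds every number below `q ^ k`.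
    rw [List.getElem_append_left (by simpa using hv), List.getElem_replicate, mul_comm, pow_mul]
    exact Nat.pow_le_pow_left (Nat.lt_size_self q).le k
  · refine ⟨by simp [decisionM]; omega, ?_⟩
    simp only [decisionM]
    rw [List.getElem_append_right (by simp), List.getElem_replicate]
  · have := row_lt hv hx
    refine ⟨by simp [decisionM]; omega, ?_⟩
    simp only [decisionM]
    rw [List.getElem_append_right (by simp; omega), List.getElem_replicate]

/-- The `n * q ^ k` table bits dominate: the registers have `O(log (n * q))` bits each, and a code
needs only `k * Nat.size q` bits. -/
theorem decision_space (P : WProg) (b : ℕ) {n : ℕ} (G : SimpleGraph (Fin n)) (S : Finset (Fin n))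
    {q k : ℕ} (hk : 1 ≤ k) (hkq : k ≤ q) :
    P.spaceBits (decisionM b G S q k) ≤ ((insert 0 P.registers).card * b + k + 3) *
      (k ^ k * k.factorial) * (q.choose k * n) := by
  have hqK : q ≤ q ^ k := Nat.le_self_pow (by omega) q
  have h1 : Nat.size (n * q) ≤ q ^ k * n := (size_le_self _).trans
    (by rw [mul_comm]; exact Nat.mul_le_mul_right n hqK)
  have h2 : max 1 (k * Nat.size q) ≤ k * q ^ k + 1 := by
    have := Nat.mul_le_mul_left k ((size_le_self q).trans hqK)
    omega
  have h3 : n ≤ q ^ k * n := Nat.le_mul_of_pos_left n (Nat.pow_pos (by omega))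
  have h4 := pow_le_mul_choose hk hkq
  calc P.spaceBits (decisionM b G S q k)
      = (insert 0 P.registers).card * (b * Nat.size (n * q)) +
        (n * max 1 (k * Nat.size q) + (n + n * q ^ k)) := by
        simp [WProg.spaceBits, decisionM]
    _ ≤ (insert 0 P.registers).card * (b * (q ^ k * n)) + (n * (k * q ^ k + 1) +
        (n + n * q ^ k)) := by gcongr
    _ = ((insert 0 P.registers).card * b + k + 1) * (q ^ k * n) + (n + n) := by ring
    _ ≤ ((insert 0 P.registers).card * b + k + 1) * (q ^ k * n) + (q ^ k * n + q ^ k * n) := by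
        omega
    _ = ((insert 0 P.registers).card * b + k + 3) * (q ^ k * n) := by ring
    _ ≤ ((insert 0 P.registers).card * b + k + 3) * (k ^ k * k.factorial * q.choose k * n) := by
        gcongr
    _ = _ := by ring

theorem decision_correct {k : ℕ} (i : ℕ) (hk : 1 ≤ k) :
    ∃ (P : WProg) (b c : ℕ), ∀ (q n : ℕ) (G : SimpleGraph (Fin n)) (S : Finset (Fin n)),
      k ≤ q → 1 ≤ n → IsFeedbackVertexSet G S →
      ∃ (M : WMachine) (t out : ℕ),
        M.w = b * Nat.size (n * q) ∧ M.input = q :: encodeGraph G S ∧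
        P.Outputs M t out ∧
        (out = 0 ∨ out = 1) ∧ (out = 1 ↔ QKIColorable G q k i) ∧
        t ≤ c * (q.choose k) ^ (S.card + 2) * n ^ 4 ∧
        P.spaceBits M ≤ c * (q.choose k * n) := by
  obtain ⟨c, hc⟩ := decide_runs 1 k i
  set c₁ := 3 + c * (k ^ k * k.factorial) ^ 2
  set c₂ := ((insert 0 (decisionP k i).registers).card * (k + 5 + (k * k + i)) + k + 3) *
    (k ^ k * k.factorial)
  refine ⟨decisionP k i, k + 5 + (k * k + i), c₁ + c₂, ?_⟩
  intro q n G S hkq hn hS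
  have hM := decisionM_fit G S i hk hkq hn
  have hq : 0 < q := by omega
  have hrun := WProg.Runs.seq (p := .assign 1 (.input (.lit 0))) (σ := WState.start)
    (Q₁ := fun τ => τ.regs 1 = q)
    (.assign (.input (.lit (Nat.pow_pos (by omega))) (a := 0) (b := q) rfl (by
      have := hM.q_le; have := hM.K_lt; omega)) (by simp))
    (fun τ hτ => hc hM hτ (natAdj_symm G) (natAdj_irrefl G) hS.isForest)
  obtain ⟨t, σ, h1, h2, h3⟩ := hrun
  refine ⟨_, t, σ.regs 0, rfl, rfl, ⟨σ, h1, rfl⟩, ?_, ?_, ?_, ?_⟩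
  · have := ind_le_one (∃ h, IsCodeColoring (natAdj G) n q k i h)
    omega
  · rw [h3, qkiColorable_iff hq]
    unfold ind
    split_ifs with h <;> simp [h]
  · rw [countBelow_natMem] at h2
    have h4 := Nat.mul_le_mul_left c (pow_mul_pow_le (s := S.card) (n := n) hk hkq)
    have h5 : 1 ≤ q.choose k ^ (S.card + 2) * n ^ 3 :=
      Nat.mul_pos (Nat.pow_pos (Nat.choose_pos hkq)) (Nat.pow_pos hn)
    calc t ≤ 3 * (q.choose k ^ (S.card + 2) * n ^ 3) + c * ((k ^ k * k.factorial) ^ 2 *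
        (q.choose k ^ (S.card + 2) * n ^ 3)) := by
          simp only [WExpr.cost] at h2
          omega
      _ = c₁ * (q.choose k ^ (S.card + 2) * n ^ 3) := by ring
      -- Here `n ^ 3` would do; the exponent is raised to share `d = 4` with the optimization
      -- problem.
      _ ≤ (c₁ + c₂) * (q.choose k ^ (S.card + 2) * n ^ 4) :=
          Nat.mul_le_mul (by omega) (Nat.mul_le_mul_left _ (Nat.pow_le_pow_right hn (by omega)))
      _ = _ := by ring
  · exact (decision_space _ _ G S hk hkq).trans (Nat.mul_le_mul_right _ (by omega))

/-- Try `k, k + 1, …` colors. -/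
def chromaticP (k i : ℕ) : WProg :=
  .seq (.assign 1 (.lit k)) (.seq (decideP 0 k i)
    (.seq (.loop (WExpr.reg 0).neg (.seq (.assign 1 (.op .add (.reg 1) (.lit 1))) (decideP 0 k i)))
      (.assign 0 (.reg 1))))

/-- The machine for the optimization problem. -/
noncomputable def chromaticM (b : ℕ) {n : ℕ} (G : SimpleGraph (Fin n)) (S : Finset (Fin n))
    (k : ℕ) : WMachine where
  w := b * Nat.size n
  input := encodeGraph G S
  cells := List.replicate (n + n + n * (k * (S.card + 2)) ^ k) (b * Nat.size n)

/-- One machine, sized for `k * (|S| + 2)` colors, serves all smaller `q` as well. As `|S| ≤ n`,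
such `q` are polynomial in `n`, so words of `O(log n)` bits suffice. -/
theorem chromaticM_fit {n : ℕ} (G : SimpleGraph (Fin n)) (S : Finset (Fin n)) {q k : ℕ} (i : ℕ)
    (hk : 1 ≤ k) (hkq : k ≤ q) (hn : 1 ≤ n) (hq : q ≤ k * (S.card + 2)) :
    Fit (chromaticM ((k + 3) * (k + 5 + (k * k + i))) G S k) 0 n q k i (q ^ k) (natAdj G)
      (natMem S) := by
  have hs : S.card ≤ n := by simpa using S.card_le_univ
  have hsize : 1 ≤ Nat.size n := Nat.size_pos.2 hn
  have hX : n < 2 ^ Nat.size n := Nat.lt_size_self _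
  have hX' : 2 ^ Nat.size n ≤ (2 ^ Nat.size n) ^ (k + 3) := Nat.le_self_pow (by omega) _
  have hqX : q < (2 ^ Nat.size n) ^ (k + 3) := by
    have h1 : k < 2 ^ k := Nat.lt_two_pow_self
    have h2 : 2 ^ k ≤ (2 ^ Nat.size n) ^ k := Nat.pow_le_pow_left (by omega) k
    have h3 : 2 * 2 ≤ 2 ^ Nat.size n * 2 ^ Nat.size n := Nat.mul_le_mul (by omega) (by omega)
    calc q ≤ k * (S.card + 2) := hq
      _ ≤ k * (3 * n) := Nat.mul_le_mul_left k (by omega)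
      _ < (2 ^ Nat.size n) ^ k * (4 * 2 ^ Nat.size n) :=
          Nat.mul_lt_mul'' (by omega) (by omega)
      _ ≤ (2 ^ Nat.size n) ^ k * ((2 ^ Nat.size n * 2 ^ Nat.size n) * 2 ^ Nat.size n) :=
          Nat.mul_le_mul_left _ (Nat.mul_le_mul_right _ h3)
      _ = (2 ^ Nat.size n) ^ (k + 3) := by ring
  have hw : ((2 ^ Nat.size n) ^ (k + 3)) ^ (k + 5 + (k * k + i)) ≤
      2 ^ ((k + 3) * (k + 5 + (k * k + i)) * Nat.size n) := by
    rw [← pow_mul, ← pow_mul]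
    exact le_of_eq (congrArg _ (by ring))
  obtain ⟨b1, b2, b3⟩ := word_bounds (n := n) (q := q) (k := k) (i := i)
    (o := 0) (by omega) (by omega) hqX (by omega) hw
  have hK : q ^ k ≤ (k * (S.card + 2)) ^ k := Nat.pow_le_pow_left hq k
  have hnK : n * q ^ k ≤ n * (k * (S.card + 2)) ^ k := Nat.mul_le_mul_left n hK
  have hb : 1 ≤ (k + 3) * (k + 5 + (k * k + i)) * Nat.size n :=
    Nat.mul_pos (Nat.mul_pos (by omega) (by omega)) hsize
  refine ⟨hn, hk, hkq, rfl, rfl, fun v hv => ?_, fun u hu v hv => ?_, b1, b2, b3, fun v hv => ?_,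
    fun v hv => ?_, fun v hv x hx => ?_⟩
  · rw [zero_add]
    exact encodeGraph_getD_mem G S hv
  · rw [zero_add]
    exact encodeGraph_getD_adj G S hu hv
  · refine ⟨by simp [chromaticM]; omega, ?_⟩
    simp only [chromaticM, List.getElem_replicate]
    have : 1 * q ^ k ≤ n * q ^ k := Nat.mul_le_mul_right _ hn
    omega
  · exact ⟨by simp [chromaticM]; omega, by simpa [chromaticM] using hb⟩
  · have := row_lt hv hx
    exact ⟨by simp [chromaticM]; omega, by simpa [chromaticM] using hb⟩

theorem chromatic_correct {k : ℕ} (i : ℕ) (hk : 1 ≤ k) :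
    ∃ (P : WProg) (b c : ℕ) (f : ℕ → ℕ), Computable f ∧
      (∀ s : ℕ, f s ≤ c * (Nat.log 2 (k * (s + 2)) * (k * (s + 2)).choose k ^ (s + 2))) ∧
      ∀ (n : ℕ) (G : SimpleGraph (Fin n)) (S : Finset (Fin n)),
        1 ≤ n → IsFeedbackVertexSet G S →
        ∃ (M : WMachine) (t out : ℕ),
          M.w = b * Nat.size n ∧ M.input = encodeGraph G S ∧
          P.Outputs M t out ∧ IsKIChromaticNumber G k i out ∧
          t ≤ f S.card * n ^ 4 := by
  obtain ⟨c, hc⟩ := decide_runs 0 k i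
  set c₁ := c * (k ^ k * k.factorial) ^ 2 with hc₁
  set c₂ := 4 + c₁ + 3 * k * (c₁ + 8) with hc₂
  refine ⟨chromaticP k i, (k + 3) * (k + 5 + (k * k + i)), c₂,
    fun s => c₂ * (k * (s + 2)).choose k ^ (s + 2), computable_choose_pow c₂ k, ?_, ?_⟩
  · intro s
    -- The function `f` has no logarithmic factor at all; it satisfies the bound because the
    -- logarithm is at least one.
    have h1 : 1 ≤ Nat.log 2 (k * (s + 2)) := Nat.log_pos (by omega)
      ((by omega : 2 ≤ 1 * (s + 2)).trans (Nat.mul_le_mul_right _ hk))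
    exact Nat.mul_le_mul_left _ (Nat.le_mul_of_pos_left _ h1)
  intro n G S hn hS
  set s := S.card with hs
  set Q := k * (s + 2) with hQ
  have hsn : s ≤ n := by simpa using S.card_le_univ
  obtain ⟨χ, hχ, hmin⟩ : ∃ χ, QKIColorable G χ k i ∧ ∀ m < χ, ¬QKIColorable G m k i :=
    by
      classical
      have hex : ∃ χ, QKIColorable G χ k i := ⟨Q, hS.qkiColorable k i⟩
      exact ⟨Nat.find hex, Nat.find_spec hex, fun m hm => Nat.find_min hex hm⟩
  have hχQ : χ ≤ Q := by
    by_contra h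
    exact hmin Q (by omega) (hS.qkiColorable k i)
  -- There is a vertex, and it needs `k` colors; so starting the search at `k` misses nothing.
  have hkχ : k ≤ χ := by
    obtain ⟨h, h1, -⟩ := hχ
    rw [← h1 ⟨0, hn⟩]
    simpa using (h ⟨0, hn⟩).card_le_univ
  set A := Q.choose k ^ (s + 2) * n ^ 3 with hA
  have hkQ : k ≤ Q := hkχ.trans hχQ
  have hA1 : 1 ≤ A := Nat.mul_pos (Nat.pow_pos (Nat.choose_pos hkQ)) (Nat.pow_pos hn)
  set M := chromaticM ((k + 3) * (k + 5 + (k * k + i))) G S k with hMdef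
  have hM : ∀ q, k ≤ q → q ≤ Q → Fit M 0 n q k i (q ^ k) (natAdj G) (natMem S) :=
    fun q h1 h2 => chromaticM_fit G S i hk h1 hn h2
  -- By monotonicity of the binomial coefficient every call is charged at the price of the largest
  -- number of colors.
  have hdec : ∀ q, k ≤ q → q ≤ Q → ∀ τ : WState, τ.regs 1 = q →
      (decideP 0 k i).Runs M τ (c₁ * A)
        (fun ρ => ρ.regs 1 = q ∧ ρ.regs 0 = ind (QKIColorable G q k i)) := by
    intro q h1 h2 τ hτ
    refine (hc (hM q h1 h2) hτ (natAdj_symm G) (natAdj_irrefl G) hS.isForest).frame.mono ?_ ?_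
    · rw [countBelow_natMem, ← hs, hc₁, mul_assoc c]
      refine Nat.mul_le_mul_left c ((pow_mul_pow_le hk h1).trans (Nat.mul_le_mul_left _ ?_))
      exact Nat.mul_le_mul_right _ (Nat.pow_le_pow_left (Nat.choose_le_choose k h2) _)
    · rintro ρ ⟨h3, h4⟩
      refine ⟨(h4 1 (keeps_decideP (by simp))).trans hτ, ?_⟩
      rw [h3, qkiColorable_iff (by omega)]
  have hMQ := hM Q hkQ le_rfl
  have hQw : Q < 2 ^ M.w := by
    have := hMQ.K_lt
    have := hMQ.q_le
    omega
  have hrun : (chromaticP k i).Runs M WState.start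
      (2 + (c₁ * A + ((χ - k + 1) * (4 + c₁ * A + 3 + 1) + 2))) (fun τ => τ.regs 0 = χ) := by
    refine .seq (Q₁ := fun τ => τ.regs 1 = k) (.assign (.lit (by omega)) (by simp)) ?_
    intro τ hτ
    refine .seq (hdec k le_rfl hkQ τ hτ) ?_
    rintro τ ⟨h1, h2⟩
    refine .seq (Q₁ := fun τ => τ.regs 1 = χ) ((WProg.Runs.loop (T := 4 + c₁ * A)
      (fun j τ => τ.regs 1 = k + j ∧ τ.regs 0 = ind (QKIColorable G (k + j) k i)) (N := χ - k)
      ⟨h1, h2⟩ ?_ ?_).mono ?_ ?_) ?_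
    · rintro j hj τ ⟨h3, h4⟩ -
      refine (WExpr.HasVal.neg (hMQ.val_ind h4) hMQ.one_lt).congr (ind_congr ?_)
      constructor
      · intro h
        by_contra h5
        rw [show k + j = χ by omega] at h
        exact h hχ
      · intro h
        exact hmin _ (by omega)
    · rintro j hj τ ⟨h3, h4⟩ -
      refine .seq (Q₁ := fun τ => τ.regs 1 = k + (j + 1)) (.assign (.add (.reg h3 (by omega))
        (.lit hMQ.one_lt) (by omega)) (by simp; omega)) ?_
      intro ρ hρ
      exact hdec _ (by omega) (by omega) ρ hρ
    · simp [WExpr.cost, WExpr.neg]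
    · rintro τ ⟨⟨h3, -⟩, -⟩
      show τ.regs 1 = χ
      omega
    · intro τ hτ
      exact .assign (.reg hτ (by omega)) (by simp)
  obtain ⟨t, σ, h1, h2, h3⟩ := hrun
  refine ⟨M, t, χ, rfl, rfl, ⟨σ, h1, h3⟩, ⟨hχ, fun m hm => ?_⟩, ?_⟩
  · by_contra h
    exact hmin m (by omega) hm
  -- The number of calls is at most linear in `n`, which turns `n ^ 3` into `n ^ 4`.
  · have hQn : χ - k + 1 ≤ 3 * k * n := by
      have h4 : Q ≤ k * (3 * n) := Nat.mul_le_mul_left k (by omega)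
      have h5 : k * (3 * n) = 3 * k * n := by ring
      omega
    have h6 : A ≤ A * n := Nat.le_mul_of_pos_right A hn
    calc t ≤ 2 + (c₁ * A + ((χ - k + 1) * (4 + c₁ * A + 3 + 1) + 2)) := h2
      _ = 4 + c₁ * A + (χ - k + 1) * (c₁ * A + 8) := by ring
      _ ≤ 4 * A + c₁ * A + (3 * k * n) * (c₁ * A + 8 * A) := by
          refine Nat.add_le_add (by omega) (Nat.mul_le_mul hQn (by omega))
      _ = (4 + c₁) * A + 3 * k * (c₁ + 8) * (A * n) := by ring
      _ ≤ (4 + c₁) * (A * n) + 3 * k * (c₁ + 8) * (A * n) :=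
          Nat.add_le_add_right (Nat.mul_le_mul_left _ h6) _
      _ = c₂ * Q.choose k ^ (s + 2) * n ^ 4 := by rw [hc₂, hA]; ring

theorem mainTheorem4 :
    ∃ d : ℕ, ∀ k i : ℕ, 1 ≤ k →
      -- the decision problem: the input is `q`, `G` and a feedback vertex set `S` of `G`
      (∃ (P : WProg) (b c : ℕ), ∀ (q n : ℕ) (G : SimpleGraph (Fin n)) (S : Finset (Fin n)),
        k ≤ q → 1 ≤ n → IsFeedbackVertexSet G S →
        ∃ (M : WMachine) (t out : ℕ),
          M.w = b * Nat.size (n * q) ∧ M.input = q :: encodeGraph G S ∧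
          P.Outputs M t out ∧
          (out = 0 ∨ out = 1) ∧ (out = 1 ↔ QKIColorable G q k i) ∧
          t ≤ c * (q.choose k) ^ (S.card + 2) * n ^ d ∧
          P.spaceBits M ≤ c * (q.choose k * n)) ∧
      -- the optimization problem is fixed-parameter tractable: the input is `G` and a feedback
      -- vertex set `S` of `G`, the parameter is `|S|`, and `k`, `i` are fixed
      (∃ (P : WProg) (b c : ℕ) (f : ℕ → ℕ), Computable f ∧
        (∀ s : ℕ, f s ≤ c * (Nat.log 2 (k * (s + 2)) * (k * (s + 2)).choose k ^ (s + 2))) ∧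
        ∀ (n : ℕ) (G : SimpleGraph (Fin n)) (S : Finset (Fin n)),
          1 ≤ n → IsFeedbackVertexSet G S →
          ∃ (M : WMachine) (t out : ℕ),
            M.w = b * Nat.size n ∧ M.input = encodeGraph G S ∧
            P.Outputs M t out ∧ IsKIChromaticNumber G k i out ∧
            t ≤ f S.card * n ^ d) := by
  exact ⟨4, fun k i hk => ⟨decision_correct i hk, chromatic_correct i hk⟩⟩
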